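/- Let $n\ge 2$, let $\mathbb{B}^n$ be the open unit ball of $\mathbb{R}^n$, and let $\overline{\mathbb{R}}^n=\mathbb{R}^n\cup\{\infty\}$ be the one-point compactification. For a domain $G\subset\mathbb{R}^n$ and $1\le K<\infty$, a map $f\colon G\to\mathbb{R}^n$ is $K$-quasiconformal if it is a homeomorphism onto $f(G)$, belongs to $W^{1,n}_{\mathrm{loc}}(G)$, and satisfies $|f'(x)|^n\le K J_f(x)$ and $J_f(x)\le K\,l(f'(x))^n$ for a.e. $x\in G$, where $|f'(x)|=\max_{|h|=1}|f'(x)h|$ and $l(f'(x))=\min_{|h|=1}|f'(x)h|$. A homeomorphism $f$ of $\overline{\mathbb{R}}^n$ onto itself is $K$-quasiconformal if its restriction to $\mathbb{R}^n\setminus\{f^{-1}(\infty)\}$ is. A set $D\subset\overline{\mathbb{R}}^n$ is a $K$-quasiball if $D=f(\mathbb{B}^n)$ for some $K$-quasiconformal mapping $f$ of $\overline{\mathbb{R}}^n$ onto itself. Two balls $B_i=\{x\in\mathbb{R}^n:|x-x_i|<r_i\}$, $r_i>0$, $i=1,2$, intersect properly if $|r_2-r_1|<|x_1-x_2|<r_1+r_2$.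 The wedge of angle $\alpha$ with starting angle $\gamma\in\mathbb{R}$ is the set of all points $(r\cos\varphi,\,r\sin\varphi,\,z)$ with $r>0$, $\gamma<\varphi<\gamma+\alpha$ and $z\in\mathbb{R}^{n-2}$. Möbius transformations are the elements of the group of bijections of $\overline{\mathbb{R}}^n$ generated by the inversions in spheres and the reflections in hyperplanes. Corollary. If the balls $B_1,B_2\subset\mathbb{R}^n$ intersect properly, then there is exactly one number $\alpha=\alpha(B_1,B_2)\in(\pi,2\pi)$, the angle of intersection of $B_1$ and $B_2$, such that some Möbius transformation maps $B_1\cup B_2$ onto a wedge of angle $\alpha$; and $B_1\cup B_2$ is a $K$-quasiball, where $K<\infty$ depends only on $n$ and $\alpha(B_1,B_2)$. -/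

import Mathlib

open Set MeasureTheory
open scoped OnePoint

noncomputable section

namespace QuasiballUnion

/-- Euclidean `n`-space; `OnePoint (E n)` is its one-point compactification. -/
abbrev E (n : ℕ) : Type := EuclideanSpace ℝ (Fin n)

/-! ### Sobolev functions and quasiregular mappings -/

/-- `Df` is a weak (distributional) derivative of `f` on the open set `G`:
`∫ ∂ᵥφ • f = - ∫ φ • (Df v)` for all test functions `φ ∈ C_c^∞(G)` and all directions `v`. -/
def IsWeakDerivOn {n : ℕ} (G : Set (E n)) (f : E n → E n) (Df : E n → E n →L[ℝ] E n) : Prop :=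
  ∀ φ : E n → ℝ, ContDiff ℝ ((⊤ : ℕ∞) : WithTop ℕ∞) φ → HasCompactSupport φ → tsupport φ ⊆ G →
    ∀ v : E n, ∫ x, (fderiv ℝ φ x v) • f x = - ∫ x, φ x • Df x v

/-- `f` is in `W^{1,p}_loc(G)`, with weak derivative `Df`. -/
structure IsSobolevLocWith {n : ℕ} (p : ENNReal) (G : Set (E n)) (f : E n → E n)
    (Df : E n → E n →L[ℝ] E n) : Prop where
  memLp : ∀ C : Set (E n), IsCompact C → C ⊆ G → MemLp f p (volume.restrict C)
  memLp_deriv : ∀ C : Set (E n), IsCompact C → C ⊆ G → MemLp Df p (volume.restrict C)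
  isWeakDeriv : IsWeakDerivOn G f Df

/-- `l(A) = min_{|h| = 1} |A h|`. -/
def minStretch {n : ℕ} (A : E n →L[ℝ] E n) : ℝ :=
  ⨅ h : Metric.sphere (0 : E n) 1, ‖A h‖

/-- `f` is `K`-quasiregular in the domain `G`, i.e. it is continuous, of class `W^{1,n}_loc(G)`,
and both its outer and its inner dilatation are at most `K`, where `1 ≤ K < ∞`. The dilatations are
the smallest constants in the two inequalities, which are required here to hold with `K`. -/
def IsQuasiregularOn {n : ℕ} (K : ℝ) (G : Set (E n)) (f : E n → E n) : Prop :=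
  1 ≤ K ∧ ContinuousOn f G ∧
    ∃ Df : E n → E n →L[ℝ] E n, IsSobolevLocWith (n : ENNReal) G f Df ∧
      ∀ᵐ x ∂(volume.restrict G),
        ‖Df x‖ ^ n ≤ K * (Df x).det ∧ (Df x).det ≤ K * minStretch (Df x) ^ n

/-- `f` is `K`-quasiconformal in the domain `G`: a `K`-quasiregular homeomorphism of `G` onto
`f G`. -/
def IsQuasiconformalOn {n : ℕ} (K : ℝ) (G : Set (E n)) (f : E n → E n) : Prop :=
  IsQuasiregularOn K G f ∧ Topology.IsEmbedding (G.domRestrict f)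

/-! ### Quasiconformal mappings of the extended space, quasiballs -/

/-- The points of `ℝⁿ` that are mapped into `ℝⁿ`; this is `ℝⁿ \ {f⁻¹(∞)}`. -/
def finiteDomain {n : ℕ} (f : OnePoint (E n) ≃ₜ OnePoint (E n)) : Set (E n) :=
  {x | f (x : OnePoint (E n)) ≠ ∞}

/-- The mapping that `f` induces from `finiteDomain f` into `ℝⁿ` (with value `0` elsewhere). -/
def finitePart {n : ℕ} (f : OnePoint (E n) ≃ₜ OnePoint (E n)) (x : E n) : E n :=
  (f (x : OnePoint (E n))).elim 0 id

/-- A homeomorphism of the extended space onto itself is `K`-quasiconformal if it is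
`K`-quasiconformal away from `∞` and `f⁻¹(∞)`. -/
def IsQuasiconformalExt {n : ℕ} (K : ℝ) (f : OnePoint (E n) ≃ₜ OnePoint (E n)) : Prop :=
  IsQuasiconformalOn K (finiteDomain f) (finitePart f)

/-- A set `A ⊆ ℝⁿ` as a subset of the extended space. -/
def toExt {n : ℕ} (A : Set (E n)) : Set (OnePoint (E n)) :=
  (fun x : E n => (x : OnePoint (E n))) '' A

/-- `G` is a `K`-quasiball: the image of the open unit ball under a `K`-quasiconformal mapping of
the extended space onto itself. -/
def IsQuasiball {n : ℕ} (K : ℝ) (G : Set (OnePoint (E n))) : Prop :=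
  ∃ f : OnePoint (E n) ≃ₜ OnePoint (E n),
    IsQuasiconformalExt K f ∧ f '' toExt (Metric.ball (0 : E n) 1) = G

/-! ### Möbius transformations -/

open Classical in
/-- Inversion in the sphere with centre `c` and radius `r`, on the extended space. -/
def sphereInv {n : ℕ} (c : E n) (r : ℝ) (p : OnePoint (E n)) : OnePoint (E n) :=
  p.elim (c : OnePoint (E n))
    (fun x => if x = c then ∞ else (EuclideanGeometry.inversion c r x : E n))

theorem sphereInv_involutive {n : ℕ} (c : E n) {r : ℝ} (hr : 0 < r) :
    Function.Involutive (sphereInv c r) := by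
  intro p
  induction p using OnePoint.rec with
  | infty => simp [sphereInv]
  | coe x =>
    by_cases h : x = c
    · simp [sphereInv, h]
    · simp [sphereInv, h, EuclideanGeometry.inversion_eq_center hr.ne',
        EuclideanGeometry.inversion_inversion c hr.ne']

/-- Reflection in the hyperplane `{x | ⟪a, x⟫ = t}` with unit normal `a`, on the extended space. -/
def hyperplaneRefl {n : ℕ} (a : E n) (t : ℝ) (p : OnePoint (E n)) : OnePoint (E n) :=
  p.map (fun x => x - (2 * (inner ℝ a x - t)) • a)

theorem hyperplaneRefl_involutive {n : ℕ} {a : E n} (ha : ‖a‖ = 1) (t : ℝ) :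
    Function.Involutive (hyperplaneRefl a t) := by
  intro p
  induction p using OnePoint.rec with
  | infty => simp [hyperplaneRefl]
  | coe x =>
    simp only [hyperplaneRefl, OnePoint.map_some]
    congr 1
    rw [inner_sub_right, inner_smul_right, real_inner_self_eq_norm_sq, ha, sub_sub, ← add_smul]
    ring_nf
    simp

/-- The group of Möbius transformations of the extended space: it is generated by the inversions in
spheres and the reflections in hyperplanes. -/
def mobiusGroup (n : ℕ) : Subgroup (Equiv.Perm (OnePoint (E n))) :=
  Subgroup.closure
    ({σ | ∃ (c : E n) (r : ℝ) (hr : 0 < r), σ = (sphereInv_involutive c hr).toPerm} ∪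
      {σ | ∃ (a : E n) (t : ℝ) (ha : ‖a‖ = 1), σ = (hyperplaneRefl_involutive ha t).toPerm})

/-! ### Wedges and the angle of intersection -/

/-- The wedge `γ < φ < γ + α` of angle `α` with starting angle `γ`, in cylindrical coordinates
`(r, φ, z)` of `ℝⁿ`, `n ≥ 2` (polar coordinates if `n = 2`). The starting angle may be any real
number, so that all rotations of a wedge about `{x₁ = x₂ = 0}` are included. -/
def wedge {n : ℕ} (hn : 2 ≤ n) (γ α : ℝ) : Set (E n) :=
  {x | ∃ r φ : ℝ, 0 < r ∧ γ < φ ∧ φ < γ + α ∧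
    x ⟨0, by omega⟩ = r * Real.cos φ ∧ x ⟨1, by omega⟩ = r * Real.sin φ}

/-- `α ∈ (π, 2π)`, and some Möbius transformation maps `B₁ ∪ B₂` onto a wedge of angle `α`. For
properly intersecting balls this says that `α` is the angle of intersection `α(B₁, B₂)`. -/
def IsAngleOfIntersection {n : ℕ} (hn : 2 ≤ n) (B₁ B₂ : Set (E n)) (α : ℝ) : Prop :=
  α ∈ Ioo Real.pi (2 * Real.pi) ∧
    ∃ g ∈ mobiusGroup n, ∃ γ : ℝ, g '' toExt (B₁ ∪ B₂) = toExt (wedge hn γ α)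

end QuasiballUnion

end

noncomputable section

namespace QuasiballUnion

variable {n : ℕ}

/-! Angle. Balls, half-spaces and exteriors of balls are given by coefficients `(a, v, c)`, on which
inversions and reflections act by isometries of `lorentz`. The product of two balls with normalized
coefficients, `ρ = (r₁² + r₂² - d²) / (2 r₁ r₂)` with `d` the distance of the centres, is therefore
a Möbius invariant of the pair. A wedge of angle `α` in `(π, 2π)` is the union of two half-spaces
whose unit normals have inner product `cos (α - π)`. When a union is such a wedge, it determines the
product of any pair producing it (`IsGenPair.eq_inner_of_union_eq`). Hence `cos (α - π) = ρ`, which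
has one solution. Conversely, inversion at a common point `p` of the two spheres yields two
half-spaces, which a translation and two reflections bring to standard position.

Quasiball. After inversion at `p` the union is `{A > 0} ∪ {B > 0}` with `A`, `B` affine. Since `max
A B = (A + B) / 2 + |A - B| / 2`, a shear by a multiple of `|A - B|` along the bisector of the
normals carries the half-space `{A + B > 0}` onto it, and an inversion centred on the unit sphere
carries the unit ball onto that half-space. The shear is bi-Lipschitz with Jacobian 1, with a
constant depending only on `ρ`. The inversions are conformal, and their two orientation reversals
cancel. The composite is even locally Lipschitz on its whole finite domain
(`locallyLipschitzOn_invConj`), so its Sobolev regularity needs no removability argument. -/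

/-! ### Generalized balls -/

/-- The quadratic function `a |x|² - 2 ⟪v, x⟫ + c`. -/
def quad (a : ℝ) (v : E n) (c : ℝ) (x : E n) : ℝ := a * ‖x‖ ^ 2 - 2 * inner ℝ v x + c

/-- The generalized open ball `{a |x|² - 2 ⟪v, x⟫ + c < 0}`: a ball, an open half-space, or the
exterior of a closed ball including `∞`. -/
def genBall (a : ℝ) (v : E n) (c : ℝ) : Set (OnePoint (E n)) :=
  {p | p.elim (a < 0) (fun x => quad a v c x < 0)}

theorem infty_mem_genBall {a : ℝ} {v : E n} {c : ℝ} : ∞ ∈ genBall a v c ↔ a < 0 := Iff.rfl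

theorem coe_mem_genBall {a : ℝ} {v : E n} {c : ℝ} {x : E n} :
    (x : OnePoint (E n)) ∈ genBall a v c ↔ quad a v c x < 0 := Iff.rfl

/-- Dividing the inequality `|y - x|² < r²` by `r` gives coefficients of Lorentz square 1. -/
theorem toExt_ball (x : E n) {r : ℝ} (hr : 0 < r) :
    toExt (Metric.ball x r) = genBall (1 / r) ((1 / r) • x) ((‖x‖ ^ 2 - r ^ 2) / r) := by
  ext p
  induction p using OnePoint.rec with
  | infty => simp [toExt, infty_mem_genBall, hr.le]
  | coe y =>
    rw [coe_mem_genBall, toExt, OnePoint.coe_injective.mem_set_image, Metric.mem_ball,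
      dist_eq_norm, ← sq_lt_sq₀ (norm_nonneg _) hr.le, norm_sub_sq_real, quad, inner_smul_left,
      real_inner_comm]
    have : 1 / r * ‖y‖ ^ 2 - 2 * (starRingEnd ℝ (1 / r) * inner ℝ x y) + (‖x‖ ^ 2 - r ^ 2) / r
        = (‖y‖ ^ 2 - 2 * inner ℝ x y + ‖x‖ ^ 2 - r ^ 2) / r := by
      simp only [conj_trivial]; ring
    rw [this, div_neg_iff]
    constructor
    · intro h; right; exact ⟨by linarith, hr⟩
    · rintro (h | h) <;> linarith

/-- The Lorentz form on the coefficients of generalized balls. -/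
def lorentz (a : ℝ) (v : E n) (c a' : ℝ) (v' : E n) (c' : ℝ) : ℝ :=
  inner ℝ v v' - (a * c' + a' * c) / 2

/-- In the variable `y = x - c₀`, the inversion `y ↦ r² y / |y|²` exchanges the roles of the leading
and constant coefficients, up to powers of `r` and the positive factor `r² / |y|²`. The points `c₀`
and `∞` are exchanged accordingly. -/
theorem sphereInv_preimage_genBall (c₀ : E n) {r : ℝ} (hr : 0 < r) (a : ℝ) (v : E n) (c : ℝ) :
    sphereInv c₀ r ⁻¹' genBall a v c = genBall (quad a v c c₀ / r ^ 2)
      (v - a • c₀ + (quad a v c c₀ / r ^ 2) • c₀)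
      (quad a v c c₀ / r ^ 2 * ‖c₀‖ ^ 2 + 2 * inner ℝ (v - a • c₀) c₀ + a * r ^ 2) := by
  have hr2 : 0 < r ^ 2 := by positivity
  set k := quad a v c c₀ / r ^ 2 with hk
  have hq : ∀ y : E n, quad k (v - a • c₀ + k • c₀)
      (k * ‖c₀‖ ^ 2 + 2 * inner ℝ (v - a • c₀) c₀ + a * r ^ 2) (c₀ + y)
      = k * ‖y‖ ^ 2 - 2 * inner ℝ (v - a • c₀) y + a * r ^ 2 := by
    intro y
    simp only [quad, norm_add_sq_real, inner_add_left, inner_add_right, inner_sub_left,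
      real_inner_smul_left, real_inner_self_eq_norm_sq]
    ring
  ext p
  induction p using OnePoint.rec with
  | infty =>
    simp only [mem_preimage, sphereInv, OnePoint.elim_infty, coe_mem_genBall, infty_mem_genBall]
    rw [hk, div_lt_iff₀ hr2, zero_mul]
  | coe x =>
    by_cases hx : x = c₀
    · have := hq 0
      simp only [add_zero, norm_zero, inner_zero_right] at this
      simp only [mem_preimage, sphereInv, OnePoint.elim_some, hx, if_true, coe_mem_genBall,
        infty_mem_genBall, this]
      constructor
      · intro h; nlinarith
      · intro h; by_contra h'; nlinarith
    · simp only [mem_preimage, sphereInv, OnePoint.elim_some, hx, if_false, coe_mem_genBall]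
      obtain ⟨y, rfl⟩ : ∃ y, x = c₀ + y := ⟨x - c₀, by simp⟩
      have hyn : ‖y‖ ≠ 0 := by rintro h; simp [norm_eq_zero.1 h] at hx
      have hy : 0 < ‖y‖ ^ 2 := by positivity
      rw [hq, EuclideanGeometry.inversion]
      have h1 : quad a v c ((r / dist (c₀ + y) c₀) ^ 2 • (c₀ + y -ᵥ c₀) +ᵥ c₀)
          = r ^ 2 / ‖y‖ ^ 2 * (k * ‖y‖ ^ 2 - 2 * inner ℝ (v - a • c₀) y + a * r ^ 2) := by
        have hk' : quad a v c c₀ = k * r ^ 2 := by rw [hk]; field_simp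
        clear_value k
        simp only [quad] at hk'
        simp only [quad, dist_eq_norm, vsub_eq_sub, vadd_eq_add, add_sub_cancel_left,
          norm_add_sq_real, inner_add_right, inner_sub_left, real_inner_smul_left,
          real_inner_smul_right, norm_smul, mul_pow, Real.norm_eq_abs, sq_abs, div_pow,
          real_inner_comm c₀ y]
        field_simp
        linear_combination ‖y‖ ^ 2 * hk'
      rw [h1]
      have : 0 < r ^ 2 / ‖y‖ ^ 2 := by positivity
      constructor
      · intro h; by_contra h'; push Not at h'; nlinarith [mul_nonneg this.le h']
      · intro h; exact mul_neg_of_pos_of_neg this h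

theorem lorentz_sphereInv (c₀ : E n) {r : ℝ} (hr : 0 < r) (a : ℝ) (v : E n) (c : ℝ) (a' : ℝ)
    (v' : E n) (c' : ℝ) :
    lorentz (quad a v c c₀ / r ^ 2)
      (v - a • c₀ + (quad a v c c₀ / r ^ 2) • c₀)
      (quad a v c c₀ / r ^ 2 * ‖c₀‖ ^ 2 + 2 * inner ℝ (v - a • c₀) c₀ + a * r ^ 2)
      (quad a' v' c' c₀ / r ^ 2)
      (v' - a' • c₀ + (quad a' v' c' c₀ / r ^ 2) • c₀)
      (quad a' v' c' c₀ / r ^ 2 * ‖c₀‖ ^ 2 + 2 * inner ℝ (v' - a' • c₀) c₀ + a' * r ^ 2)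
      = lorentz a v c a' v' c' := by
  simp only [lorentz, quad, inner_add_left, inner_add_right, inner_sub_left, inner_sub_right,
    real_inner_smul_left, real_inner_smul_right, real_inner_self_eq_norm_sq, real_inner_comm c₀]
  field_simp
  ring

theorem hyperplaneRefl_preimage_genBall {b : E n} (hb : ‖b‖ = 1) (t a : ℝ) (v : E n) (c : ℝ) :
    hyperplaneRefl b t ⁻¹' genBall a v c = genBall a (v + (2 * (a * t - inner ℝ v b)) • b)
      (c + 4 * t * (a * t - inner ℝ v b)) := by
  ext p
  induction p using OnePoint.rec with
  | infty => simp [hyperplaneRefl, infty_mem_genBall]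
  | coe x =>
    simp only [mem_preimage, hyperplaneRefl, OnePoint.map_some, coe_mem_genBall]
    have : quad a v c (x - (2 * (inner ℝ b x - t)) • b)
        = quad a (v + (2 * (a * t - inner ℝ v b)) • b) (c + 4 * t * (a * t - inner ℝ v b)) x := by
      simp only [quad, norm_sub_sq_real, inner_add_left, inner_sub_right,
        real_inner_smul_left, real_inner_smul_right, norm_smul, mul_pow, Real.norm_eq_abs, sq_abs,
        hb, real_inner_comm x b]
      ring
    rw [this]

theorem lorentz_hyperplaneRefl {b : E n} (hb : ‖b‖ = 1) (t a : ℝ) (v : E n) (c : ℝ)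
    (a' : ℝ) (v' : E n) (c' : ℝ) :
    lorentz a (v + (2 * (a * t - inner ℝ v b)) • b) (c + 4 * t * (a * t - inner ℝ v b))
      a' (v' + (2 * (a' * t - inner ℝ v' b)) • b) (c' + 4 * t * (a' * t - inner ℝ v' b))
      = lorentz a v c a' v' c' := by
  simp only [lorentz, inner_add_left, inner_add_right, real_inner_smul_left,
    real_inner_smul_right, real_inner_self_eq_norm_sq, hb, real_inner_comm b]
  ring

/-- `S₁` and `S₂` are generalized balls with normalized coefficients of Lorentz product `p`. -/
def IsGenPair (p : ℝ) (S₁ S₂ : Set (OnePoint (E n))) : Prop :=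
  ∃ (a₁ : ℝ) (v₁ : E n) (c₁ a₂ : ℝ) (v₂ : E n) (c₂ : ℝ),
    lorentz a₁ v₁ c₁ a₁ v₁ c₁ = 1 ∧ lorentz a₂ v₂ c₂ a₂ v₂ c₂ = 1 ∧
    lorentz a₁ v₁ c₁ a₂ v₂ c₂ = p ∧ S₁ = genBall a₁ v₁ c₁ ∧ S₂ = genBall a₂ v₂ c₂

theorem IsGenPair.sphereInv {p : ℝ} {S₁ S₂ : Set (OnePoint (E n))} (h : IsGenPair p S₁ S₂)
    (c₀ : E n) {r : ℝ} (hr : 0 < r) :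
    IsGenPair p (sphereInv c₀ r ⁻¹' S₁) (QuasiballUnion.sphereInv c₀ r ⁻¹' S₂) := by
  obtain ⟨a₁, v₁, c₁, a₂, v₂, c₂, h1, h2, h3, rfl, rfl⟩ := h
  rw [sphereInv_preimage_genBall c₀ hr, sphereInv_preimage_genBall c₀ hr]
  exact ⟨_, _, _, _, _, _, by rwa [lorentz_sphereInv c₀ hr], by rwa [lorentz_sphereInv c₀ hr],
    by rwa [lorentz_sphereInv c₀ hr], rfl, rfl⟩

theorem IsGenPair.hyperplaneRefl {p : ℝ} {S₁ S₂ : Set (OnePoint (E n))} (h : IsGenPair p S₁ S₂)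
    {b : E n} (hb : ‖b‖ = 1) (t : ℝ) :
    IsGenPair p (hyperplaneRefl b t ⁻¹' S₁) (QuasiballUnion.hyperplaneRefl b t ⁻¹' S₂) := by
  obtain ⟨a₁, v₁, c₁, a₂, v₂, c₂, h1, h2, h3, rfl, rfl⟩ := h
  rw [hyperplaneRefl_preimage_genBall hb, hyperplaneRefl_preimage_genBall hb]
  exact ⟨_, _, _, _, _, _, by rwa [lorentz_hyperplaneRefl hb], by rwa [lorentz_hyperplaneRefl hb],
    by rwa [lorentz_hyperplaneRefl hb], rfl, rfl⟩

/-- Images and preimages are treated together because passing to the inverse in the induction swaps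
them. -/
theorem IsGenPair.image_mobius {g : Equiv.Perm (OnePoint (E n))} (hg : g ∈ mobiusGroup n) :
    ∀ {p : ℝ} {S₁ S₂ : Set (OnePoint (E n))}, IsGenPair p S₁ S₂ → IsGenPair p (g '' S₁) (g '' S₂) ∧
      IsGenPair p (g ⁻¹' S₁) (g ⁻¹' S₂) := by
  induction hg using Subgroup.closure_induction with
  | mem g hg =>
    intro p S₁ S₂ h
    rcases hg with ⟨c, r, hr, rfl⟩ | ⟨a, t, ha, rfl⟩
    · have := h.sphereInv c hr
      exact ⟨by rw [Equiv.image_eq_preimage_symm, Equiv.image_eq_preimage_symm]; exact this, this⟩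
    · have := h.hyperplaneRefl ha t
      exact ⟨by rw [Equiv.image_eq_preimage_symm, Equiv.image_eq_preimage_symm]; exact this, this⟩
  | one => intro p S₁ S₂ h; simpa using h
  | mul g₁ g₂ _ _ h₁ h₂ =>
    intro p S₁ S₂ h
    simp only [Equiv.Perm.coe_mul, image_comp, preimage_comp]
    exact ⟨(h₁ (h₂ h).1).1, (h₂ (h₁ h).2).2⟩
  | inv g _ hg =>
    intro p S₁ S₂ h
    have := hg h
    refine ⟨?_, ?_⟩
    · have e : ∀ S, (g⁻¹ : Equiv.Perm _) '' S = g ⁻¹' S := fun S => by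
        rw [Equiv.image_eq_preimage_symm]; rfl
      rw [e, e]; exact this.2
    · have e : ∀ S, (g⁻¹ : Equiv.Perm _) ⁻¹' S = g '' S := fun S => by
        rw [Equiv.image_eq_preimage_symm]; rfl
      rw [e, e]; exact this.1

/-! ### The Lorentz product of two generalized balls is determined by their union -/

/-- The ball of radius `M / 2` about the unit vector `x₀ = -(u₁ + u₂) / M` lies in the first cone.
Testing at `x₀ + (M / 2) vᵢ` gives `⟪vᵢ, x₀⟫ ≤ -M / 2`; adding the two and using Cauchy–Schwarz
gives the bound. For unit vectors the norm of the sum encodes the inner product. -/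
theorem norm_add_le_of_cone_subset {u₁ u₂ v₁ v₂ : E n} (hu₁ : ‖u₁‖ = 1) (hu₂ : ‖u₂‖ = 1)
    (hv₁ : ‖v₁‖ = 1) (hv₂ : ‖v₂‖ = 1)
    (h : ∀ x : E n, inner ℝ u₁ x ≤ 0 → inner ℝ u₂ x ≤ 0 → inner ℝ v₁ x ≤ 0 ∧ inner ℝ v₂ x ≤ 0) :
    ‖u₁ + u₂‖ ≤ ‖v₁ + v₂‖ := by
  rcases (norm_nonneg (u₁ + u₂)).eq_or_lt with h0 | h0
  · rw [← h0]; positivity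
  set M := ‖u₁ + u₂‖ with hM
  have hM2 : M ^ 2 = 2 + 2 * inner ℝ u₁ u₂ := by
    rw [hM, norm_add_sq_real, hu₁, hu₂]; ring
  set x₀ : E n := -(1 / M) • (u₁ + u₂) with hx₀
  have hx₀n : ‖x₀‖ = 1 := by
    rw [hx₀, norm_smul, ← hM]; simp [abs_of_pos h0, h0.ne']
  have e1 : inner ℝ u₁ x₀ = -(M / 2) := by
    rw [hx₀, real_inner_smul_right, inner_add_right, real_inner_self_eq_norm_sq, hu₁]
    field_simp; linarith
  have e2 : inner ℝ u₂ x₀ = -(M / 2) := by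
    rw [hx₀, real_inner_smul_right, inner_add_right, real_inner_self_eq_norm_sq, hu₂,
      real_inner_comm]
    field_simp; linarith
  have key : ∀ w : E n, ‖w‖ = 1 → inner ℝ v₁ (x₀ + (M / 2) • w) ≤ 0 ∧
      inner ℝ v₂ (x₀ + (M / 2) • w) ≤ 0 := by
    intro w hw
    refine h _ ?_ ?_
    · rw [inner_add_right, e1, real_inner_smul_right]
      have := real_inner_le_norm u₁ w
      rw [hu₁, hw] at this; nlinarith
    · rw [inner_add_right, e2, real_inner_smul_right]
      have := real_inner_le_norm u₂ w
      rw [hu₂, hw] at this; nlinarith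
  have f1 := (key v₁ hv₁).1
  have f2 := (key v₂ hv₂).2
  rw [inner_add_right, real_inner_smul_right _ _ (M / 2), real_inner_self_eq_norm_sq, hv₁] at f1
  rw [inner_add_right, real_inner_smul_right _ _ (M / 2), real_inner_self_eq_norm_sq, hv₂] at f2
  have f3 := neg_le_of_abs_le (abs_real_inner_le_norm (v₁ + v₂) x₀)
  rw [hx₀n, inner_add_left] at f3
  linarith

theorem exists_quad_smul_nonneg {a : ℝ} {v : E n} {c : ℝ} (ha : 0 ≤ a) (hc : 0 ≤ c) (x : E n)
    (h : 0 < a ∧ x ≠ 0 ∨ inner ℝ v x ≤ 0) : ∃ T₀ : ℝ, ∀ T ≥ T₀, 0 ≤ T → 0 ≤ quad a v c (T • x) := by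
  have e : ∀ T : ℝ, quad a v c (T • x) = T * (a * ‖x‖ ^ 2 * T - 2 * inner ℝ v x) + c := by
    intro T
    simp only [quad, norm_smul, real_inner_smul_right, mul_pow, Real.norm_eq_abs, sq_abs]; ring
  rcases h with ⟨h, hx⟩ | h
  · have hp : 0 < a * ‖x‖ ^ 2 := by positivity
    refine ⟨2 * inner ℝ v x / (a * ‖x‖ ^ 2), fun T hT hT0 => ?_⟩
    rw [e]
    rw [ge_iff_le, div_le_iff₀ hp] at hT
    have : 0 ≤ a * ‖x‖ ^ 2 * T - 2 * inner ℝ v x := by linarith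
    positivity
  · refine ⟨0, fun T hT hT0 => ?_⟩
    rw [e]
    have : 0 ≤ a * ‖x‖ ^ 2 * T := by positivity
    have : 0 ≤ a * ‖x‖ ^ 2 * T - 2 * inner ℝ v x := by linarith
    positivity

/-- The union is a cone, so it contains the open ray through each of its points. If `a₂ > 0`, the
second set is bounded, and it suffices to find a ray in the cone that also leaves the first set. If
`a₁ > 0` any ray does; if `a₁ = 0`, the direction `uᵢ - v₁` does for some `uᵢ ≠ v₁`. -/
theorem coeff_eq_zero_of_union_eq {a₁ a₂ c₁ c₂ : ℝ} {v₁ v₂ u₁ u₂ : E n} (hu₁ : ‖u₁‖ = 1)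
    (hu₂ : ‖u₂‖ = 1) (hu : u₁ ≠ u₂) (ha₁ : 0 ≤ a₁) (ha₂ : 0 ≤ a₂) (hc₁ : 0 ≤ c₁) (hc₂ : 0 ≤ c₂)
    (h1 : lorentz a₁ v₁ c₁ a₁ v₁ c₁ = 1)
    (hx : ∀ x : E n, quad a₁ v₁ c₁ x < 0 ∨ quad a₂ v₂ c₂ x < 0 ↔ 0 < inner ℝ u₁ x ∨ 0 < inner ℝ u₂ x) :
    a₂ = 0 := by
  by_contra hne
  have ha₂' : 0 < a₂ := lt_of_le_of_ne ha₂ (Ne.symm hne)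
  obtain ⟨x, hx0, hxW⟩ : ∃ x : E n, (0 < a₁ ∧ x ≠ 0 ∨ inner ℝ v₁ x ≤ 0) ∧
      (0 < inner ℝ u₁ x ∨ 0 < inner ℝ u₂ x) := by
    rcases ha₁.eq_or_lt with h0 | h0
    · have hv : ‖v₁‖ = 1 := by
        rw [← h0, lorentz, real_inner_self_eq_norm_sq] at h1
        have : ‖v₁‖ ^ 2 = 1 := by linarith
        rwa [pow_eq_one_iff_of_nonneg (norm_nonneg _) two_ne_zero] at this
      have aux : ∀ u : E n, ‖u‖ = 1 → u ≠ v₁ → inner ℝ v₁ (u - v₁) ≤ 0 ∧ 0 < inner ℝ u (u - v₁) := by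
        intro u hu hne
        have : inner ℝ u v₁ < 1 := inner_lt_one_iff_real_of_norm_eq_one hu hv |>.2 hne
        rw [inner_sub_right, inner_sub_right, real_inner_self_eq_norm_sq,
          real_inner_self_eq_norm_sq, hu, hv, real_inner_comm]
        constructor <;> linarith
      by_cases h : u₁ = v₁
      · have := aux u₂ hu₂ (fun h' => hu (h.trans h'.symm))
        exact ⟨_, Or.inr this.1, Or.inr this.2⟩
      · have := aux u₁ hu₁ h
        exact ⟨_, Or.inr this.1, Or.inl this.2⟩
    · refine ⟨u₁, Or.inl ⟨h0, ?_⟩, Or.inl ?_⟩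
      · rintro rfl; simp at hu₁
      · rw [real_inner_self_eq_norm_sq, hu₁]; norm_num
  have hxne : x ≠ 0 := by rintro rfl; simp at hxW
  obtain ⟨T₁, hT₁⟩ := exists_quad_smul_nonneg ha₁ hc₁ x hx0
  obtain ⟨T₂, hT₂⟩ := exists_quad_smul_nonneg (v := v₂) ha₂ hc₂ x (Or.inl ⟨ha₂', hxne⟩)
  set T := max 1 (max T₁ T₂)
  have hT : 0 < T := lt_of_lt_of_le one_pos (le_max_left _ _)
  have g1 := hT₁ T (le_max_of_le_right (le_max_left _ _)) hT.le
  have g2 := hT₂ T (le_max_of_le_right (le_max_right _ _)) hT.le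
  have := (hx (T • x)).2 (by
    simp only [real_inner_smul_right]
    exact hxW.imp (mul_pos hT) (mul_pos hT))
  rcases this with h | h <;> linarith

/-- Neither `∞` nor `0` lies in the union, so all `aᵢ` and `cᵢ` are nonnegative, and then `aᵢ = 0`.
The complementary cones of the two pairs of normals contain each other, so
`norm_add_le_of_cone_subset` applies in both directions. -/
theorem IsGenPair.eq_inner_of_union_eq {p : ℝ} {S₁ S₂ : Set (OnePoint (E n))}
    (h : IsGenPair p S₁ S₂) {u₁ u₂ : E n} (hu₁ : ‖u₁‖ = 1) (hu₂ : ‖u₂‖ = 1) (hu : u₁ ≠ u₂)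
    (hS : S₁ ∪ S₂ = genBall 0 u₁ 0 ∪ genBall 0 u₂ 0) : p = inner ℝ u₁ u₂ := by
  obtain ⟨a₁, v₁, c₁, a₂, v₂, c₂, h1, h2, h3, rfl, rfl⟩ := h
  have hinf : ¬ ((∞ : OnePoint (E n)) ∈ genBall a₁ v₁ c₁ ∪ genBall a₂ v₂ c₂) := by
    rw [hS]; simp [infty_mem_genBall]
  have hx : ∀ x : E n, quad a₁ v₁ c₁ x < 0 ∨ quad a₂ v₂ c₂ x < 0 ↔
      0 < inner ℝ u₁ x ∨ 0 < inner ℝ u₂ x := by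
    intro x
    have := Set.ext_iff.1 hS x
    simpa [coe_mem_genBall, quad] using this
  simp only [mem_union, infty_mem_genBall, not_or, not_lt] at hinf
  obtain ⟨ha₁, ha₂⟩ := hinf
  have h0 := hx 0
  simp only [quad, norm_zero, inner_zero_right, lt_irrefl, or_self, iff_false, not_or, not_lt] at h0
  have hc₁ : 0 ≤ c₁ := by linarith [h0.1]
  have hc₂ : 0 ≤ c₂ := by linarith [h0.2]
  obtain rfl := coeff_eq_zero_of_union_eq hu₁ hu₂ hu ha₁ ha₂ hc₁ hc₂ h1 hx
  obtain rfl := coeff_eq_zero_of_union_eq hu₁ hu₂ hu ha₂ ha₁ hc₂ hc₁ h2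
    (fun x => by rw [or_comm]; exact hx x)
  simp only [lorentz, zero_mul, add_zero, zero_div, sub_zero, real_inner_self_eq_norm_sq] at h1 h2 h3
  have hv₁ : ‖v₁‖ = 1 := by
    rwa [pow_eq_one_iff_of_nonneg (norm_nonneg _) two_ne_zero] at h1
  have hv₂ : ‖v₂‖ = 1 := by
    rwa [pow_eq_one_iff_of_nonneg (norm_nonneg _) two_ne_zero] at h2
  -- Scaling to infinity removes the constant term.
  have hlin : ∀ {v x : E n} {c : ℝ}, (∀ T : ℝ, 0 < T → 0 ≤ quad 0 v c (T • x)) → inner ℝ v x ≤ 0 := by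
    intro v x c h
    by_contra! hv
    have := h ((|c| + 1) / inner ℝ v x) (by positivity)
    rw [quad, real_inner_smul_right, div_mul_cancel₀ _ hv.ne'] at this
    have := le_abs_self c
    have := abs_nonneg c
    linarith
  have hA := norm_add_le_of_cone_subset hu₁ hu₂ hv₁ hv₂ (by
    intro x g1 g2
    have : ∀ T : ℝ, 0 < T → 0 ≤ quad 0 v₁ c₁ (T • x) ∧ 0 ≤ quad 0 v₂ c₂ (T • x) := by
      intro T hT
      have := (hx (T • x)).not.2 (by
        simp only [real_inner_smul_right, not_or, not_lt]
        exact ⟨mul_nonpos_of_nonneg_of_nonpos hT.le g1, mul_nonpos_of_nonneg_of_nonpos hT.le g2⟩)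
      simpa using this
    exact ⟨hlin fun T hT => (this T hT).1, hlin fun T hT => (this T hT).2⟩)
  -- No scaling is needed here: `cᵢ ≥ 0` already puts `x` outside both half-spaces.
  have hB := norm_add_le_of_cone_subset hv₁ hv₂ hu₁ hu₂ (by
    intro x g1 g2
    have := (hx x).not.1 (by
      simp only [quad, not_or, not_lt]
      constructor <;> linarith)
    simpa using this)
  have hE := le_antisymm hA hB
  have e1 := norm_add_sq_real u₁ u₂
  have e2 := norm_add_sq_real v₁ v₂
  rw [hE, hu₁, hu₂] at e1
  rw [hv₁, hv₂] at e2
  linarith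

/-! ### Wedges as unions of two half-spaces -/

/-- The unit normal of the half-space `γ < φ < γ + π`. -/
def wedgeNormal (hn : 2 ≤ n) (γ : ℝ) : E n :=
  EuclideanSpace.single ⟨0, by omega⟩ (-Real.sin γ) + EuclideanSpace.single ⟨1, by omega⟩ (Real.cos γ)

theorem inner_wedgeNormal (hn : 2 ≤ n) (γ : ℝ) (x : E n) :
    inner ℝ (wedgeNormal hn γ) x =
      x ⟨1, by omega⟩ * Real.cos γ - x ⟨0, by omega⟩ * Real.sin γ := by
  simp [wedgeNormal, inner_add_left, EuclideanSpace.inner_single_left]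
  ring

theorem inner_wedgeNormal_wedgeNormal (hn : 2 ≤ n) (γ δ : ℝ) :
    inner ℝ (wedgeNormal hn γ) (wedgeNormal hn δ) = Real.cos (δ - γ) := by
  rw [inner_wedgeNormal, Real.cos_sub]
  simp [wedgeNormal]

theorem norm_wedgeNormal (hn : 2 ≤ n) (γ : ℝ) : ‖wedgeNormal hn γ‖ = 1 := by
  have := inner_wedgeNormal_wedgeNormal hn γ γ
  rw [sub_self, Real.cos_zero, real_inner_self_eq_norm_sq] at this
  rwa [pow_eq_one_iff_of_nonneg (norm_nonneg _) two_ne_zero] at this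

/-- After rotation by `-γ` the point has positive imaginary part, so its argument lies in `(0, π)`.
-/
theorem exists_polar_of_pos {a b γ : ℝ} (h : 0 < b * Real.cos γ - a * Real.sin γ) :
    ∃ r φ : ℝ, 0 < r ∧ γ < φ ∧ φ < γ + Real.pi ∧ a = r * Real.cos φ ∧ b = r * Real.sin φ := by
  set a' := a * Real.cos γ + b * Real.sin γ with ha'
  set b' := b * Real.cos γ - a * Real.sin γ with hb'
  set z : ℂ := ⟨a', b'⟩ with hz
  have hz0 : z ≠ 0 := by
    intro h'
    have := congrArg Complex.im h'
    simp [hz] at this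
    linarith
  have hsc := Real.sin_sq_add_cos_sq γ
  have hre : ‖z‖ * Real.cos z.arg = a' := Complex.norm_mul_cos_arg z
  have him : ‖z‖ * Real.sin z.arg = b' := Complex.norm_mul_sin_arg z
  have hzn : 0 < ‖z‖ := norm_pos_iff.2 hz0
  have h0 : 0 ≤ z.arg := Complex.arg_nonneg_iff.2 h.le
  have hsin : Real.sin z.arg ≠ 0 := by
    intro h'; rw [h', mul_zero] at him; linarith
  have h1 : 0 < z.arg := lt_of_le_of_ne h0 (fun h' => hsin (by rw [← h', Real.sin_zero]))
  have h2 : z.arg < Real.pi :=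
    lt_of_le_of_ne (Complex.arg_le_pi z) (fun h' => hsin (by rw [h', Real.sin_pi]))
  refine ⟨‖z‖, γ + z.arg, hzn, by linarith, by linarith, ?_, ?_⟩
  · rw [Real.cos_add]
    linear_combination (-Real.cos γ) * hre + Real.sin γ * him + Real.cos γ * ha' - Real.sin γ * hb'
      - a * hsc
  · rw [Real.sin_add]
    linear_combination (-Real.sin γ) * hre - Real.cos γ * him + Real.sin γ * ha' + Real.cos γ * hb'
      - b * hsc

/-- As `π < α < 2π`, the intervals of length `π` at the two ends of `(γ, γ + α)` lie inside it and
cover it. -/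
theorem toExt_wedge (hn : 2 ≤ n) {γ α : ℝ} (hα : α ∈ Ioo Real.pi (2 * Real.pi)) :
    toExt (wedge hn γ α) = genBall 0 (wedgeNormal hn γ) 0 ∪
      genBall 0 (wedgeNormal hn (γ + α - Real.pi)) 0 := by
  ext p
  induction p using OnePoint.rec with
  | infty => simp [toExt, infty_mem_genBall]
  | coe x =>
    rw [toExt, OnePoint.coe_injective.mem_set_image, mem_union, coe_mem_genBall, coe_mem_genBall]
    have hq : ∀ δ, quad 0 (wedgeNormal hn δ) 0 x < 0 ↔
        0 < x ⟨1, by omega⟩ * Real.cos δ - x ⟨0, by omega⟩ * Real.sin δ := by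
      intro δ
      rw [quad, inner_wedgeNormal]
      constructor <;> intro h <;> linarith
    rw [hq, hq]
    constructor
    · rintro ⟨r, φ, hr, h1, h2, hx, hy⟩
      have e : ∀ δ, x ⟨1, by omega⟩ * Real.cos δ - x ⟨0, by omega⟩ * Real.sin δ
          = r * Real.sin (φ - δ) := by
        intro δ; rw [hx, hy, Real.sin_sub]; ring
      rw [e, e]
      by_cases h : φ < γ + Real.pi
      · exact Or.inl (mul_pos hr (Real.sin_pos_of_pos_of_lt_pi (by linarith) (by linarith)))
      · exact Or.inr (mul_pos hr (Real.sin_pos_of_pos_of_lt_pi (by linarith [hα.2]) (by linarith)))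
    · rintro (h | h)
      · obtain ⟨r, φ, hr, h1, h2, hx, hy⟩ := exists_polar_of_pos h
        exact ⟨r, φ, hr, h1, by linarith [hα.1], hx, hy⟩
      · obtain ⟨r, φ, hr, h1, h2, hx, hy⟩ := exists_polar_of_pos h
        exact ⟨r, φ, hr, by linarith [hα.1], by linarith, hx, hy⟩

/-! ### Existence and uniqueness of the angle of intersection -/

/-- Translation by `y` is the product of two reflections in hyperplanes orthogonal to `y` at
distance `|y| / 2`. -/
theorem exists_mobius_translate (y : E n) : ∃ g ∈ mobiusGroup n, ∀ (v : E n) (c : ℝ),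
    g '' genBall 0 v c = genBall 0 v (c + 2 * inner ℝ v y) := by
  rcases eq_or_ne y 0 with rfl | hy
  · exact ⟨1, one_mem _, fun v c => by simp⟩
  have hyn : ‖y‖ ≠ 0 := norm_ne_zero_iff.2 hy
  have hb : ‖(1 / ‖y‖) • y‖ = 1 := by
    rw [norm_smul, Real.norm_of_nonneg (by positivity), one_div_mul_cancel hyn]
  refine ⟨(hyperplaneRefl_involutive hb (‖y‖ / 2)).toPerm * (hyperplaneRefl_involutive hb 0).toPerm,
    mul_mem (Subgroup.subset_closure (Or.inr ⟨_, _, hb, rfl⟩))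
      (Subgroup.subset_closure (Or.inr ⟨_, _, hb, rfl⟩)), fun v c => ?_⟩
  rw [Equiv.Perm.coe_mul, image_comp, Equiv.image_eq_preimage_symm, Equiv.image_eq_preimage_symm]
  change hyperplaneRefl _ _ ⁻¹' (hyperplaneRefl _ _ ⁻¹' _) = _
  rw [hyperplaneRefl_preimage_genBall hb, hyperplaneRefl_preimage_genBall hb]
  set b := (1 / ‖y‖) • y with hbdef
  have hyb : y = ‖y‖ • b := by rw [hbdef, smul_smul, mul_one_div_cancel hyn, one_smul]
  have hbb : inner ℝ b b = (1 : ℝ) := by rw [real_inner_self_eq_norm_sq, hb]; norm_num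
  congr 1
  · rw [inner_add_left, real_inner_smul_left, hbb, add_assoc, ← add_smul]
    rw [add_eq_left]
    convert zero_smul ℝ b
    ring
  · rw [inner_add_left, real_inner_smul_left, hbb]
    conv_rhs => rw [hyb, real_inner_smul_right]
    ring

/-- If `u ≠ v`, reflect in the hyperplane bisecting them. The last clause lets a second such map
move one normal while keeping another fixed. -/
theorem exists_mobius_rotate {u v : E n} (hu : ‖u‖ = 1) (hv : ‖v‖ = 1) :
    ∃ g ∈ mobiusGroup n, ∃ A : E n → E n, (∀ w, g '' genBall 0 w 0 = genBall 0 (A w) 0) ∧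
      (∀ w w', inner ℝ (A w) (A w') = (inner ℝ w w' : ℝ)) ∧ A u = v ∧
      ∀ w, inner ℝ w u = (inner ℝ w v : ℝ) → A w = w := by
  rcases eq_or_ne u v with rfl | hne
  · exact ⟨1, one_mem _, id, by simp, by simp, rfl, by simp⟩
  have hd : ‖u - v‖ ≠ 0 := norm_ne_zero_iff.2 (sub_ne_zero.2 hne)
  have hb : ‖(1 / ‖u - v‖) • (u - v)‖ = 1 := by
    rw [norm_smul, Real.norm_of_nonneg (by positivity), one_div_mul_cancel hd]
  have h2 : ‖u - v‖ ^ 2 = 2 - 2 * inner ℝ u v := by rw [norm_sub_sq_real, hu, hv]; ring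
  refine ⟨(hyperplaneRefl_involutive hb 0).toPerm,
    Subgroup.subset_closure (Or.inr ⟨_, _, hb, rfl⟩),
    fun w => w + (2 * (0 * 0 - inner ℝ w ((1 / ‖u - v‖) • (u - v)))) • ((1 / ‖u - v‖) • (u - v)),
    fun w => ?_, fun w w' => ?_, ?_, fun w hw => ?_⟩
  · rw [Equiv.image_eq_preimage_symm]
    change hyperplaneRefl _ _ ⁻¹' _ = _
    rw [hyperplaneRefl_preimage_genBall hb]
    simp
  · have := lorentz_hyperplaneRefl hb 0 0 w 0 0 w' 0
    simpa [lorentz] using this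
  · simp only [real_inner_smul_right, inner_sub_right, real_inner_self_eq_norm_sq, hu, smul_smul]
    have : 2 * (0 * 0 - 1 / ‖u - v‖ * (1 ^ 2 - inner ℝ u v)) * (1 / ‖u - v‖) = -1 := by
      field_simp
      linarith
    rw [this, neg_one_smul]; abel
  · simp only [real_inner_smul_right, inner_sub_right, hw]
    simp

/-- The sphere about `x₁` is connected because `n ≥ 2`. At its two points on the line of centres the
distance to `x₂` is `|d - r₁| ≤ r₂` and `d + r₁ ≥ r₂`, where `d = dist x₁ x₂`. -/
theorem exists_dist_eq_dist_eq (hn : 2 ≤ n) {x₁ x₂ : E n} {r₁ r₂ : ℝ} (hr₁ : 0 < r₁)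
    (h1 : |r₂ - r₁| < dist x₁ x₂) (h2 : dist x₁ x₂ < r₁ + r₂) :
    ∃ p : E n, dist x₁ p = r₁ ∧ dist x₂ p = r₂ := by
  have hD : 0 < dist x₁ x₂ := lt_of_le_of_lt (abs_nonneg _) h1
  have hDn : ‖x₁ - x₂‖ = dist x₁ x₂ := (dist_eq_norm _ _).symm
  have hrank : 1 < Module.rank ℝ (E n) := by
    rw [← Module.finrank_eq_rank, finrank_euclideanSpace_fin]
    exact_mod_cast hn
  have hc := isPreconnected_sphere hrank x₁ r₁
  have hmem : ∀ s : ℝ, |s| = r₁ → x₁ + (s / dist x₁ x₂) • (x₁ - x₂) ∈ Metric.sphere x₁ r₁ := by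
    intro s hs
    rw [Metric.mem_sphere, dist_eq_norm, add_sub_cancel_left, norm_smul, hDn, Real.norm_eq_abs,
      abs_div, hs, abs_of_pos hD, div_mul_cancel₀ _ hD.ne']
  have hdist : ∀ s : ℝ, dist x₂ (x₁ + (s / dist x₁ x₂) • (x₁ - x₂)) = |dist x₁ x₂ + s| := by
    intro s
    have : x₁ + (s / dist x₁ x₂) • (x₁ - x₂) - x₂ = ((dist x₁ x₂ + s) / dist x₁ x₂) • (x₁ - x₂) := by
      rw [add_div, div_self hD.ne', add_smul, one_smul]; abel
    rw [dist_comm, dist_eq_norm, this, norm_smul, hDn, Real.norm_eq_abs, abs_div, abs_of_pos hD,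
      div_mul_cancel₀ _ hD.ne']
  have hI := hc.intermediate_value (f := fun y => dist x₂ y)
    (hmem (-r₁) (by rw [abs_neg, abs_of_pos hr₁])) (hmem r₁ (abs_of_pos hr₁))
    (by fun_prop)
  rw [abs_lt] at h1
  obtain ⟨p, hp, hp2⟩ := hI (show r₂ ∈ _ by
    constructor
    · rw [hdist, abs_le]; constructor <;> linarith
    · rw [hdist]; exact le_trans (by linarith) (le_abs_self _))
  exact ⟨p, by rw [dist_comm]; exact hp, hp2⟩

theorem sphereInv_preimage_ball {x p : E n} {r : ℝ} (hr : 0 < r) (h : dist x p = r) :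
    sphereInv p 1 ⁻¹' toExt (Metric.ball x r) =
      genBall 0 ((1 / r) • (x - p)) (2 * inner ℝ ((1 / r) • (x - p)) p + 1 / r) := by
  have hq : quad (1 / r) ((1 / r) • x) ((‖x‖ ^ 2 - r ^ 2) / r) p = 0 := by
    have h2 : ‖x - p‖ ^ 2 = r ^ 2 := by rw [← dist_eq_norm, h]
    rw [norm_sub_sq_real] at h2
    rw [quad, real_inner_smul_left]
    field_simp
    linarith
  rw [toExt_ball x hr, sphereInv_preimage_genBall p one_pos, hq]
  simp only [zero_div, zero_smul, add_zero, zero_mul, zero_add, smul_sub, one_pow, mul_one]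

theorem norm_normal {x p : E n} {r : ℝ} (hr : 0 < r) (h : dist x p = r) :
    ‖(1 / r) • (x - p)‖ = 1 := by
  rw [norm_smul, ← dist_eq_norm, h, Real.norm_of_nonneg (by positivity),
    one_div_mul_cancel hr.ne']

theorem inner_normal {x₁ x₂ p : E n} {r₁ r₂ : ℝ} (hr₁ : 0 < r₁) (hr₂ : 0 < r₂)
    (h₁ : dist x₁ p = r₁) (h₂ : dist x₂ p = r₂) :
    inner ℝ ((1 / r₁) • (x₁ - p)) ((1 / r₂) • (x₂ - p)) =
      (r₁ ^ 2 + r₂ ^ 2 - dist x₁ x₂ ^ 2) / (2 * r₁ * r₂) := by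
  have h := norm_sub_sq_real (x₁ - p) (x₂ - p)
  rw [← dist_eq_norm x₁, ← dist_eq_norm x₂, h₁, h₂, sub_sub_sub_cancel_right, ← dist_eq_norm] at h
  rw [real_inner_smul_left, real_inner_smul_right, h]
  field_simp
  ring

theorem lorentzProduct_mem {D r₁ r₂ : ℝ} (hr₁ : 0 < r₁) (hr₂ : 0 < r₂) (h1 : |r₂ - r₁| < D)
    (h2 : D < r₁ + r₂) : (r₁ ^ 2 + r₂ ^ 2 - D ^ 2) / (2 * r₁ * r₂) ∈ Ioo (-1 : ℝ) 1 := by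
  have hD : 0 < D := lt_of_le_of_lt (abs_nonneg _) h1
  rw [abs_lt] at h1
  constructor
  · rw [lt_div_iff₀ (by positivity)]; nlinarith
  · rw [div_lt_iff₀ (by positivity)]; nlinarith

theorem isGenPair_ball {x₁ x₂ : E n} {r₁ r₂ : ℝ} (hr₁ : 0 < r₁) (hr₂ : 0 < r₂) :
    IsGenPair ((r₁ ^ 2 + r₂ ^ 2 - dist x₁ x₂ ^ 2) / (2 * r₁ * r₂))
      (toExt (Metric.ball x₁ r₁)) (toExt (Metric.ball x₂ r₂)) := by
  refine ⟨_, _, _, _, _, _, ?_, ?_, ?_, toExt_ball x₁ hr₁, toExt_ball x₂ hr₂⟩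
  · rw [lorentz, real_inner_self_eq_norm_sq, norm_smul, Real.norm_of_nonneg (by positivity)]
    field_simp; ring
  · rw [lorentz, real_inner_self_eq_norm_sq, norm_smul, Real.norm_of_nonneg (by positivity)]
    field_simp; ring
  · rw [lorentz, real_inner_smul_left, real_inner_smul_right, dist_eq_norm, norm_sub_sq_real]
    field_simp; ring

theorem toExt_union (A B : Set (E n)) : toExt (A ∪ B) = toExt A ∪ toExt B := image_union _ _ _

theorem wedgeNormal_ne (hn : 2 ≤ n) {γ δ : ℝ} (h : Real.cos (δ - γ) ≠ 1) :
    wedgeNormal hn γ ≠ wedgeNormal hn δ := by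
  intro h'
  have := inner_wedgeNormal_wedgeNormal hn γ δ
  rw [← h', real_inner_self_eq_norm_sq, norm_wedgeNormal] at this
  exact h (by rw [← this]; norm_num)

theorem cos_of_isAngleOfIntersection (hn : 2 ≤ n) {x₁ x₂ : E n} {r₁ r₂ α : ℝ} (hr₁ : 0 < r₁)
    (hr₂ : 0 < r₂)
    (h : IsAngleOfIntersection hn (Metric.ball x₁ r₁) (Metric.ball x₂ r₂) α) :
    Real.cos (α - Real.pi) = (r₁ ^ 2 + r₂ ^ 2 - dist x₁ x₂ ^ 2) / (2 * r₁ * r₂) := by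
  obtain ⟨hα, g, hg, γ, h⟩ := h
  rw [toExt_wedge hn hα, toExt_union, image_union] at h
  have e : γ + α - Real.pi - γ = α - Real.pi := by ring
  have hne : Real.cos (γ + α - Real.pi - γ) ≠ 1 := by
    rw [e]
    have := Real.cos_lt_cos_of_nonneg_of_le_pi le_rfl (y := α - Real.pi) (by linarith [hα.2])
      (by linarith [hα.1])
    rw [Real.cos_zero] at this
    exact this.ne
  have := ((isGenPair_ball hr₁ hr₂).image_mobius hg).1.eq_inner_of_union_eq
    (norm_wedgeNormal hn _) (norm_wedgeNormal hn _) (wedgeNormal_ne hn hne) h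
  rw [this, inner_wedgeNormal_wedgeNormal, e]

theorem exists_isAngleOfIntersection (hn : 2 ≤ n) {x₁ x₂ : E n} {r₁ r₂ : ℝ} (hr₁ : 0 < r₁)
    (hr₂ : 0 < r₂) (h1 : |r₂ - r₁| < dist x₁ x₂) (h2 : dist x₁ x₂ < r₁ + r₂) :
    ∃ α, IsAngleOfIntersection hn (Metric.ball x₁ r₁) (Metric.ball x₂ r₂) α := by
  have hρ := lorentzProduct_mem hr₁ hr₂ h1 h2
  obtain ⟨p, hp₁, hp₂⟩ := exists_dist_eq_dist_eq hn hr₁ h1 h2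
  set ρ := (r₁ ^ 2 + r₂ ^ 2 - dist x₁ x₂ ^ 2) / (2 * r₁ * r₂) with hρdef
  have hu₁ := norm_normal hr₁ hp₁
  have hu₂ := norm_normal hr₂ hp₂
  have hu := inner_normal hr₁ hr₂ hp₁ hp₂
  have hS₁ := sphereInv_preimage_ball hr₁ hp₁
  have hS₂ := sphereInv_preimage_ball hr₂ hp₂
  rw [← hρdef] at hu
  set u₁ := (1 / r₁) • (x₁ - p)
  set u₂ := (1 / r₂) • (x₂ - p)
  generalize 2 * inner ℝ u₁ p + 1 / r₁ = c₁ at hS₁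
  generalize 2 * inner ℝ u₂ p + 1 / r₂ = c₂ at hS₂
  have hi₁ : (1 + ρ : ℝ) ≠ 0 := by linarith [hρ.1]
  have hi₂ : (1 - ρ : ℝ) ≠ 0 := by linarith [hρ.2]
  -- Translation by `y` moves both bounding hyperplanes through `0`. The system is solved in the
  -- orthogonal directions `u₁ + u₂` and `u₁ - u₂`, of squared norms `2 (1 ± ρ)`.
  obtain ⟨y, hy₁, hy₂⟩ : ∃ y : E n, c₁ + 2 * inner ℝ u₁ y = 0 ∧ c₂ + 2 * inner ℝ u₂ y = 0 := by
    refine ⟨-(((c₁ + c₂) / (4 * (1 + ρ))) • (u₁ + u₂) + ((c₁ - c₂) / (4 * (1 - ρ))) • (u₁ - u₂)),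
      ?_, ?_⟩
    · simp only [inner_neg_right, inner_add_right, inner_sub_right, real_inner_smul_right,
        real_inner_self_eq_norm_sq, hu₁, hu]
      field_simp; ring
    · simp only [inner_neg_right, inner_add_right, inner_sub_right, real_inner_smul_right,
        real_inner_self_eq_norm_sq, hu₂, real_inner_comm u₁ u₂ ▸ hu]
      field_simp; ring
  obtain ⟨g₁, hg₁, hT⟩ := exists_mobius_translate y
  obtain ⟨g₂, hg₂, A, hA, hAi, hAu, -⟩ := exists_mobius_rotate hu₁ (norm_wedgeNormal hn 0)
  have hAu₂ : ‖A u₂‖ = 1 := by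
    have := hAi u₂ u₂
    rw [real_inner_self_eq_norm_sq, real_inner_self_eq_norm_sq, hu₂] at this
    rwa [one_pow, pow_eq_one_iff_of_nonneg (norm_nonneg _) two_ne_zero] at this
  obtain ⟨g₃, hg₃, B, hB, -, hBu, hBf⟩ :=
    exists_mobius_rotate hAu₂ (norm_wedgeNormal hn (Real.arccos ρ))
  -- `A u₂` and its target both have inner product `ρ` with the first normal.
  have hB₀ : B (wedgeNormal hn 0) = wedgeNormal hn 0 := hBf _ (by
    rw [inner_wedgeNormal_wedgeNormal, sub_zero, Real.cos_arccos hρ.1.le hρ.2.le, ← hAu, hAi, hu])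
  have hα : Real.pi + Real.arccos ρ ∈ Ioo Real.pi (2 * Real.pi) := by
    have := Real.arccos_pos.2 hρ.2
    have : Real.arccos ρ < Real.pi := by
      refine lt_of_le_of_ne (Real.arccos_le_pi ρ) fun h => ?_
      rw [Real.arccos_eq_pi] at h
      linarith [hρ.1]
    constructor <;> linarith
  refine ⟨Real.pi + Real.arccos ρ, hα, g₃ * g₂ * g₁ * (sphereInv_involutive p one_pos).toPerm,
    mul_mem (mul_mem (mul_mem hg₃ hg₂) hg₁) (Subgroup.subset_closure (Or.inl ⟨_, _, one_pos, rfl⟩)),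
    0, ?_⟩
  have hI : ∀ S, (sphereInv_involutive p one_pos).toPerm '' S = sphereInv p 1 ⁻¹' S := fun S => by
    rw [Equiv.image_eq_preimage_symm]; rfl
  rw [toExt_wedge hn hα, Equiv.Perm.coe_mul, Equiv.Perm.coe_mul, Equiv.Perm.coe_mul, image_comp,
    image_comp, image_comp, hI, toExt_union, preimage_union, hS₁, hS₂, image_union, hT, hT, hy₁,
    hy₂, image_union, hA, hA, image_union, hB, hB, hAu, hB₀, hBu]
  congr 3
  ring

theorem existsUnique_isAngleOfIntersection (hn : 2 ≤ n) {x₁ x₂ : E n} {r₁ r₂ : ℝ} (hr₁ : 0 < r₁)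
    (hr₂ : 0 < r₂) (h1 : |r₂ - r₁| < dist x₁ x₂) (h2 : dist x₁ x₂ < r₁ + r₂) :
    ∃! α, IsAngleOfIntersection hn (Metric.ball x₁ r₁) (Metric.ball x₂ r₂) α := by
  refine existsUnique_of_exists_of_unique (exists_isAngleOfIntersection hn hr₁ hr₂ h1 h2) ?_
  intro α β hα hβ
  have h := (cos_of_isAngleOfIntersection hn hr₁ hr₂ hα).trans
    (cos_of_isAngleOfIntersection hn hr₁ hr₂ hβ).symm
  have := Real.injOn_cos ⟨by linarith [hα.1.1], by linarith [hα.1.2]⟩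
    ⟨by linarith [hβ.1.1], by linarith [hβ.1.2]⟩ h
  linarith

/-! ### Locally Lipschitz mappings are Sobolev mappings -/

theorem exists_bound_fderiv_of_isCompact {G C : Set (E n)} (hG : IsOpen G) {f : E n → E n}
    (hf : LocallyLipschitzOn G f) (hC : IsCompact C) (hCG : C ⊆ G) :
    ∃ M : ℝ, ∀ x ∈ C, ‖fderiv ℝ f x‖ ≤ M := by
  refine hC.induction_on (p := fun s => ∃ M : ℝ, ∀ x ∈ s, ‖fderiv ℝ f x‖ ≤ M) ⟨0, by simp⟩
    (fun s t hst ⟨M, hM⟩ => ⟨M, fun x hx => hM x (hst hx)⟩)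
    (fun s t ⟨M, hM⟩ ⟨M', hM'⟩ => ⟨max M M', ?_⟩) ?_
  · rintro x (hx | hx)
    · exact (hM x hx).trans (le_max_left _ _)
    · exact (hM' x hx).trans (le_max_right _ _)
  · intro x hx
    obtain ⟨K, t, ht, hK⟩ := hf (hCG hx)
    rw [hG.nhdsWithin_eq (hCG hx)] at ht
    refine ⟨interior t, mem_nhdsWithin_of_mem_nhds (interior_mem_nhds.2 ht), K, fun y hy => ?_⟩
    exact norm_fderiv_le_of_lipschitzOn ℝ (mem_interior_iff_mem_nhds.1 hy) hK

/-- Pairing with a fixed vector reduces this to integration by parts for scalar Lipschitz functions;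
by Rademacher the line derivatives come from `fderiv` almost everywhere. -/
theorem integral_fderiv_smul_eq_of_lipschitzWith {g : E n → E n} {C : NNReal}
    (hg : LipschitzWith C g) {φ : E n → ℝ} (hφ : ContDiff ℝ ((⊤ : ℕ∞) : WithTop ℕ∞) φ)
    (hφc : HasCompactSupport φ) (v : E n) :
    ∫ x, (fderiv ℝ φ x v) • g x = - ∫ x, φ x • fderiv ℝ g x v := by
  have hφ1 : ContDiff ℝ 1 φ := hφ.of_le (by exact_mod_cast le_top)
  obtain ⟨D, hD⟩ := hφ1.lipschitzWith_of_hasCompactSupport hφc (by simp)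
  have hcd : Continuous fun x => fderiv ℝ φ x v :=
    (hφ1.continuous_fderiv (by simp)).clm_apply continuous_const
  have hi1 : Integrable fun x => (fderiv ℝ φ x v) • g x := by
    refine (hcd.smul hg.continuous).integrable_of_hasCompactSupport ?_
    exact HasCompactSupport.smul_right (hφc.fderiv_apply ℝ v)
  have hi2 : Integrable fun x => φ x • fderiv ℝ g x v := by
    refine Integrable.mono' ((hφ1.continuous.norm.integrable_of_hasCompactSupport
      hφc.norm).mul_const (C * ‖v‖)) ?_ (Filter.Eventually.of_forall fun x => ?_)
    · exact hφ1.continuous.aestronglyMeasurable.smul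
        (measurable_fderiv_apply_const ℝ g v).aestronglyMeasurable
    · rw [norm_smul]
      have := (fderiv ℝ g x).le_of_opNorm_le (norm_fderiv_le_of_lipschitz ℝ hg (x₀ := x)) v
      gcongr
  refine ext_inner_left ℝ fun w => ?_
  rw [inner_neg_right, ← integral_inner hi1, ← integral_inner hi2]
  have hh : LipschitzWith (‖innerSL ℝ w‖₊ * C) fun x => innerSL ℝ w (g x) :=
    (innerSL ℝ w).lipschitz.comp hg
  have key := LipschitzWith.integral_lineDeriv_mul_eq (μ := volume) hh hD hφc v
  have e1 : ∫ x, inner ℝ w (φ x • fderiv ℝ g x v)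
      = ∫ x, lineDeriv ℝ (fun x => innerSL ℝ w (g x)) x v * φ x := by
    refine integral_congr_ae ?_
    filter_upwards [hg.ae_differentiableAt (μ := volume)] with x hx
    have := ((innerSL ℝ w).hasFDerivAt.comp x hx.hasFDerivAt).hasLineDerivAt v
    have h2 := this.lineDeriv
    simp only [Function.comp_def] at h2
    rw [h2, real_inner_smul_right]
    simp [mul_comm]
  have e2 : ∫ x, inner ℝ w ((fderiv ℝ φ x v) • g x)
      = - ∫ x, lineDeriv ℝ φ x (-v) * innerSL ℝ w (g x) := by
    rw [← integral_neg]
    congr 1 with x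
    rw [((hφ1.differentiable (by simp)) x).lineDeriv_eq_fderiv, real_inner_smul_right]
    simp
  rw [e2, e1, key]

/-- The weak derivative is a local notion: near the support of a test function, `f` agrees with a
globally Lipschitz map. -/
theorem isSobolevLocWith_fderiv {G : Set (E n)} (hG : IsOpen G) {f : E n → E n}
    (hf : LocallyLipschitzOn G f) (p : ENNReal) : IsSobolevLocWith p G f (fderiv ℝ f) where
  memLp C hC hCG := by
    have hfc := hf.continuousOn.mono hCG
    obtain ⟨M, hM⟩ := hC.exists_bound_of_continuousOn hfc
    have : IsFiniteMeasure (volume.restrict C) := ⟨by simpa using hC.measure_lt_top⟩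
    exact MemLp.of_bound (hfc.aestronglyMeasurable hC.measurableSet) M
      ((ae_restrict_iff' hC.measurableSet).2 (Filter.Eventually.of_forall hM))
  memLp_deriv C hC hCG := by
    obtain ⟨M, hM⟩ := exists_bound_fderiv_of_isCompact hG hf hC hCG
    have : IsFiniteMeasure (volume.restrict C) := ⟨by simpa using hC.measure_lt_top⟩
    exact MemLp.of_bound (measurable_fderiv ℝ f).aestronglyMeasurable M
      ((ae_restrict_iff' hC.measurableSet).2 (Filter.Eventually.of_forall hM))
  isWeakDeriv := by
    intro φ hφ hφc hφG v
    obtain ⟨C, hC, hC1, hC2⟩ := exists_compact_between hφc.isCompact hG hφG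
    obtain ⟨K, hK⟩ := (hf.mono hC2).exists_lipschitzOnWith_of_compact hC
    obtain ⟨g, hg, hfg⟩ := hK.extend_finite_dimension
    have key := integral_fderiv_smul_eq_of_lipschitzWith hg hφ hφc v
    have e1 : ∫ x, (fderiv ℝ φ x v) • f x = ∫ x, (fderiv ℝ φ x v) • g x := by
      congr 1 with x : 1
      by_cases hx : x ∈ tsupport φ
      · rw [hfg (interior_subset (hC1 hx))]
      · rw [show fderiv ℝ φ x = 0 from by
          by_contra h
          exact hx (support_fderiv_subset ℝ h)]
        simp
    have e2 : ∫ x, φ x • fderiv ℝ f x v = ∫ x, φ x • fderiv ℝ g x v := by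
      congr 1 with x : 1
      by_cases hx : x ∈ tsupport φ
      · rw [Filter.EventuallyEq.fderiv_eq (hfg.eventuallyEq_of_mem
          (mem_interior_iff_mem_nhds.1 (hC1 hx)))]
      · rw [image_eq_zero_of_notMem_tsupport hx, zero_smul, zero_smul]
    rw [e1, e2, key]

open Filter Topology EuclideanGeometry



/-! ### Quasiconformality of locally Lipschitz homeomorphisms -/

theorem isOpen_finiteDomain (f : OnePoint (E n) ≃ₜ OnePoint (E n)) : IsOpen (finiteDomain f) :=
  (OnePoint.isClosed_infty.preimage (f.continuous.comp OnePoint.continuous_coe)).isOpen_compl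

theorem coe_finitePart {f : OnePoint (E n) ≃ₜ OnePoint (E n)} {x : E n} (hx : x ∈ finiteDomain f) :
    (finitePart f x : OnePoint (E n)) = f x := by
  obtain ⟨y, hy⟩ := OnePoint.ne_infty_iff_exists.1 hx
  simp [finitePart, ← hy]

theorem isQuasiconformalExt_of_locallyLipschitzOn {f : OnePoint (E n) ≃ₜ OnePoint (E n)} {K : ℝ}
    (hK : 1 ≤ K) (hf : LocallyLipschitzOn (finiteDomain f) (finitePart f))
    (hd : ∀ᵐ x ∂(volume.restrict (finiteDomain f)),
      ‖fderiv ℝ (finitePart f) x‖ ^ n ≤ K * (fderiv ℝ (finitePart f) x).det ∧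
      (fderiv ℝ (finitePart f) x).det ≤ K * minStretch (fderiv ℝ (finitePart f) x) ^ n) :
    IsQuasiconformalExt K f := by
  refine ⟨⟨hK, hf.continuousOn, fderiv ℝ (finitePart f),
    isSobolevLocWith_fderiv (isOpen_finiteDomain f) hf n, hd⟩, ?_⟩
  refine Topology.IsEmbedding.of_comp (continuousOn_iff_continuous_domRestrict.1 hf.continuousOn)
    (OnePoint.continuous_coe) ?_
  have : ((↑) : E n → OnePoint (E n)) ∘ (finiteDomain f).domRestrict (finitePart f)
      = f ∘ ((↑) : E n → OnePoint (E n)) ∘ Subtype.val := by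
    ext x
    exact coe_finitePart x.2
  rw [this]
  exact f.isEmbedding.comp (OnePoint.isOpenEmbedding_coe.isEmbedding.comp IsEmbedding.subtypeVal)

/-! ### Inversions as homeomorphisms of the extended space -/

theorem tendsto_inversion_cobounded (c : E n) (r : ℝ) :
    Tendsto (inversion c r) (Bornology.cobounded (E n)) (𝓝 c) := by
  rw [tendsto_iff_dist_tendsto_zero]
  simp only [dist_inversion_center]
  exact (Metric.tendsto_dist_right_cobounded_atTop c).const_div_atTop (r ^ 2)

theorem continuous_sphereInv (c : E n) {r : ℝ} (hr : 0 < r) : Continuous (sphereInv c r) := by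
  rw [OnePoint.continuous_iff]
  constructor
  · rw [coclosedCompact_eq_cocompact, ← Metric.cobounded_eq_cocompact]
    have h := ((OnePoint.continuous_coe (X := E n)).tendsto c).comp
      (tendsto_inversion_cobounded c r)
    refine h.congr' ?_
    filter_upwards [Bornology.isBounded_def.1 (Bornology.isBounded_singleton (x := c))] with x hx
    simp only [mem_compl_iff, mem_singleton_iff] at hx
    simp [sphereInv, hx]
  · rw [continuous_iff_continuousAt]
    intro x
    by_cases hx : x = c
    · subst hx
      rw [ContinuousAt, ← nhdsNE_sup_pure, tendsto_sup]
      constructor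
      · have h := (OnePoint.tendsto_coe_infty (X := E n)).mono_left
          (coclosedCompact_eq_cocompact (X := E n) ▸ Metric.cobounded_eq_cocompact.le)
        have h2 := h.comp (tendsto_inversion_nhdsNE_center_cobounded (c := x) hr.ne')
        have e : sphereInv x r (x : OnePoint (E n)) = ∞ := by simp [sphereInv]
        rw [e]
        refine h2.congr' ?_
        filter_upwards [self_mem_nhdsWithin] with y hy
        simp only [mem_compl_iff, mem_singleton_iff] at hy
        simp [sphereInv, hy]
      · exact (tendsto_pure_nhds _ _)
    · have h : ContinuousAt (fun y => ((inversion c r y : E n) : OnePoint (E n))) x :=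
        (OnePoint.continuous_coe.continuousAt).comp
          (hasFDerivAt_inversion hx).continuousAt
      refine h.congr ?_
      filter_upwards [isOpen_compl_singleton.mem_nhds (show x ∈ ({c} : Set (E n))ᶜ from hx)] with y hy
      simp only [mem_compl_iff, mem_singleton_iff] at hy
      simp [sphereInv, hy]

/-- Inversion in a sphere as a homeomorphism of the extended space. -/
def sphereInvHomeo (c : E n) {r : ℝ} (hr : 0 < r) : OnePoint (E n) ≃ₜ OnePoint (E n) where
  toEquiv := (sphereInv_involutive c hr).toPerm
  continuous_toFun := continuous_sphereInv c hr
  continuous_invFun := continuous_sphereInv c hr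

/-! ### Conjugating a bi-Lipschitz homeomorphism by two inversions -/

/-- The composition of the inversion in the sphere of centre `q` and radius `r`, a homeomorphism
`F` of `ℝⁿ`, and the inversion in the unit sphere centred at `p`. -/
def invConj (p q : E n) {r : ℝ} (hr : 0 < r) (F : E n ≃ₜ E n) :
    OnePoint (E n) ≃ₜ OnePoint (E n) :=
  ((sphereInvHomeo q hr).trans F.onePointCongr).trans (sphereInvHomeo p one_pos)

section InvConj

variable {p q : E n} {r : ℝ} {hr : 0 < r} {F : E n ≃ₜ E n}

theorem invConj_apply (z : OnePoint (E n)) :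
    invConj p q hr F z = sphereInv p 1 (OnePoint.map F (sphereInv q r z)) := rfl

theorem mem_finiteDomain_invConj {x : E n} :
    x ∈ finiteDomain (invConj p q hr F) ↔ x = q ∨ F (inversion q r x) ≠ p := by
  by_cases hx : x = q
  · simp [finiteDomain, invConj_apply, sphereInv, hx]
  · by_cases h : F (inversion q r x) = p <;>
      simp [finiteDomain, invConj_apply, sphereInv, hx, h]

theorem finitePart_invConj_self : finitePart (invConj p q hr F) q = p := by
  simp [finitePart, invConj_apply, sphereInv]

theorem finitePart_invConj {x : E n} (hx : x ≠ q) (h : F (inversion q r x) ≠ p) :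
    finitePart (invConj p q hr F) x = inversion p 1 (F (inversion q r x)) := by
  simp [finitePart, invConj_apply, sphereInv, hx, h]

/-- This product controls the Lipschitz constant of the composite. Near `q` the inverted point is at
distance `r² / |x - q|` from `q`, and the antilipschitz bound keeps its image at a comparable
distance from `p`. -/
theorem exists_lower_bound_invConj {L : NNReal} (hFa : AntilipschitzWith L F) {x₀ : E n}
    (hx₀ : x₀ ∈ finiteDomain (invConj p q hr F)) :
    ∃ δ > 0, ∀ᶠ x in 𝓝 x₀, x = q ∨ δ ≤ dist x q * dist (F (inversion q r x)) p := by
  by_cases hx : x₀ = q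
  · subst hx
    -- `L + 1` avoids division by zero when `L = 0`.
    refine ⟨r ^ 2 / 2 / (L + 1), by positivity, ?_⟩
    set s := F.symm p
    have hlim : ∀ᶠ x in 𝓝 x₀, dist x x₀ * dist s x₀ < r ^ 2 / 2 := by
      have : ContinuousAt (fun x => dist x x₀ * dist s x₀) x₀ := by fun_prop
      refine this.eventually_lt continuousAt_const ?_
      simp only [dist_self, zero_mul]
      positivity
    filter_upwards [hlim] with x hx
    by_cases hxq : x = x₀
    · exact Or.inl hxq
    right
    have h1 : dist (inversion x₀ r x) s ≤ L * dist (F (inversion x₀ r x)) p := by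
      have := hFa.le_mul_dist (inversion x₀ r x) s
      rwa [F.apply_symm_apply] at this
    have h2 : dist (inversion x₀ r x) x₀ ≤ dist (inversion x₀ r x) s + dist s x₀ :=
      dist_triangle _ _ _
    rw [dist_inversion_center] at h2
    have hd : 0 < dist x x₀ := dist_pos.2 hxq
    have h3 : r ^ 2 / dist x x₀ * dist x x₀ = r ^ 2 := div_mul_cancel₀ _ hd.ne'
    rw [div_le_iff₀ (by positivity)]
    have h4 := mul_le_mul_of_nonneg_right (h2.trans (add_le_add_left h1 _)) hd.le
    have h5 : 0 ≤ dist (F (inversion x₀ r x)) p * dist x x₀ := by positivity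
    rw [h3] at h4
    linarith
  · have hp : F (inversion q r x₀) ≠ p := (mem_finiteDomain_invConj.1 hx₀).resolve_left hx
    have hpos : 0 < dist x₀ q * dist (F (inversion q r x₀)) p :=
      mul_pos (dist_pos.2 hx) (dist_pos.2 hp)
    refine ⟨_, half_pos hpos, ?_⟩
    have hc : ContinuousAt (fun x => dist x q * dist (F (inversion q r x)) p) x₀ := by
      have h1 : ContinuousAt (fun x => F (inversion q r x)) x₀ :=
        F.continuous.continuousAt.comp (hasFDerivAt_inversion hx).continuousAt
      exact (continuousAt_id.dist continuousAt_const).mul (h1.dist continuousAt_const)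
    filter_upwards [continuousAt_const.eventually_lt hc (half_lt_self hpos)] with x hx
    exact Or.inr hx.le

/-- Applying the distance formula for inversions twice bounds the distance of the images by `L r² |x
- y| / (Q x * Q y)`. Against the value `p` at `q`, the distance is exactly `|x - q| / Q x`. -/
theorem locallyLipschitzOn_invConj {L : NNReal} (hFl : LipschitzWith L F)
    (hFa : AntilipschitzWith L F) :
    LocallyLipschitzOn (finiteDomain (invConj p q hr F)) (finitePart (invConj p q hr F)) := by
  intro x₀ hx₀
  obtain ⟨δ, hδ, hev⟩ := exists_lower_bound_invConj hFa hx₀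
  set Q : E n → ℝ := fun x => dist x q * dist (F (inversion q r x)) p with hQ
  set M : ℝ := max (L * r ^ 2 / δ ^ 2) (1 / δ) with hM
  have hM0 : 0 ≤ M := le_max_of_le_right (by positivity)
  refine ⟨M.toNNReal, _, mem_nhdsWithin_of_mem_nhds hev, LipschitzOnWith.of_dist_le_mul ?_⟩
  rw [Real.coe_toNNReal _ hM0]
  have hne : ∀ x, δ ≤ Q x → x ≠ q ∧ F (inversion q r x) ≠ p := by
    intro x hx
    constructor
    · rintro rfl; simp [hQ] at hx; linarith
    · intro h; simp [hQ, h] at hx; linarith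
  have hone : ∀ x, δ ≤ Q x → dist (finitePart (invConj p q hr F) x) p ≤ M * dist x q := by
    intro x hx
    obtain ⟨h1, h2⟩ := hne x hx
    rw [finitePart_invConj h1 h2, dist_inversion_center]
    have hd1 : 0 < dist x q := dist_pos.2 h1
    have hd2 : 0 < dist (F (inversion q r x)) p := dist_pos.2 h2
    have : (1 : ℝ) ^ 2 / dist (F (inversion q r x)) p = 1 / Q x * dist x q := by
      simp only [hQ]; field_simp
    rw [this]
    gcongr
    exact (one_div_le_one_div_of_le hδ hx).trans (le_max_right _ _)
  intro x hx y hy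
  rcases hx with rfl | hx <;> rcases hy with rfl | hy
  · simp
  · rw [finitePart_invConj_self, dist_comm, dist_comm x]
    exact hone y hy
  · rw [finitePart_invConj_self]
    exact hone x hx
  · obtain ⟨h1, h2⟩ := hne x hx
    obtain ⟨h3, h4⟩ := hne y hy
    rw [finitePart_invConj h1 h2, finitePart_invConj h3 h4, dist_inversion_inversion h2 h4]
    have hd1 : 0 < dist x q := dist_pos.2 h1
    have hd2 : 0 < dist (F (inversion q r x)) p := dist_pos.2 h2
    have hd3 : 0 < dist y q := dist_pos.2 h3
    have hd4 : 0 < dist (F (inversion q r y)) p := dist_pos.2 h4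
    have hF := hFl.dist_le_mul (inversion q r x) (inversion q r y)
    rw [dist_inversion_inversion h1 h3] at hF
    calc 1 ^ 2 / (dist (F (inversion q r x)) p * dist (F (inversion q r y)) p) *
          dist (F (inversion q r x)) (F (inversion q r y))
        ≤ 1 ^ 2 / (dist (F (inversion q r x)) p * dist (F (inversion q r y)) p) *
          (L * (r ^ 2 / (dist x q * dist y q) * dist x y)) := by gcongr
      _ = L * r ^ 2 / (Q x * Q y) * dist x y := by simp only [hQ]; field_simp
      _ ≤ L * r ^ 2 / δ ^ 2 * dist x y := by
        rw [sq δ]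
        gcongr
      _ ≤ M * dist x y := by gcongr; exact le_max_left _ _

/-! ### Dilatation of the conjugated mapping -/

theorem det_reflection_orthogonal_singleton {y : E n} (hy : y ≠ 0) :
    LinearMap.det ((ℝ ∙ y)ᗮ.reflection.toLinearMap : E n →ₗ[ℝ] E n) = -1 := by
  rw [Submodule.det_reflection, Submodule.orthogonal_orthogonal, finrank_span_singleton hy, pow_one]

/-- The factors around `A` are similarities whose determinants have sign -1 each, so the signs
cancel and `det D = (ν μ)ⁿ`, while all stretches of `D` lie between `ν μ / L` and `L ν μ`. -/
theorem dilatation_bounds [Nontrivial (E n)] {A : E n →L[ℝ] E n} {L μ ν : ℝ} (hL : 1 ≤ L)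
    (hμ : 0 < μ) (hν : 0 < ν) (hdet : LinearMap.det (A : E n →ₗ[ℝ] E n) = 1)
    (hA₁ : ∀ h, ‖A h‖ ≤ L * ‖h‖) (hA₂ : ∀ h, ‖h‖ ≤ L * ‖A h‖) {y z : E n} (hy : y ≠ 0) (hz : z ≠ 0)
    {D : E n →L[ℝ] E n} (hD : D = (ν • ((ℝ ∙ z)ᗮ.reflection : E n →L[ℝ] E n)).comp
      (A.comp (μ • ((ℝ ∙ y)ᗮ.reflection : E n →L[ℝ] E n)))) :
    ‖D‖ ^ n ≤ L ^ n * D.det ∧ D.det ≤ L ^ n * minStretch D ^ n := by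
  have hL0 : 0 < L := by linarith
  have happ : ∀ h, ‖D h‖ = ν * ‖A (μ • (ℝ ∙ y)ᗮ.reflection h)‖ := by
    intro h
    rw [hD]
    simp [norm_smul, abs_of_pos hν]
    ring
  have hnm : ∀ h, ‖μ • (ℝ ∙ y)ᗮ.reflection h‖ = μ * ‖h‖ := by
    intro h
    rw [norm_smul, Real.norm_of_nonneg hμ.le, LinearIsometryEquiv.norm_map]
  have hDdet : D.det = (ν * μ) ^ n := by
    have h1 : (D : E n →ₗ[ℝ] E n) = (ν • ((ℝ ∙ z)ᗮ.reflection.toLinearMap : E n →ₗ[ℝ] E n)) ∘ₗ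
        ((A : E n →ₗ[ℝ] E n) ∘ₗ (μ • ((ℝ ∙ y)ᗮ.reflection.toLinearMap : E n →ₗ[ℝ] E n))) := by
      rw [hD]; rfl
    rw [ContinuousLinearMap.det, h1, LinearMap.det_comp, LinearMap.det_comp, LinearMap.det_smul,
      LinearMap.det_smul, det_reflection_orthogonal_singleton hy,
      det_reflection_orthogonal_singleton hz, hdet, finrank_euclideanSpace_fin]
    ring
  have hup : ‖D‖ ≤ L * (ν * μ) := by
    refine D.opNorm_le_bound (by positivity) fun h => ?_
    rw [happ]
    have := hA₁ (μ • (ℝ ∙ y)ᗮ.reflection h)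
    rw [hnm] at this
    calc ν * ‖A (μ • (ℝ ∙ y)ᗮ.reflection h)‖ ≤ ν * (L * (μ * ‖h‖)) := by gcongr
      _ = L * (ν * μ) * ‖h‖ := by ring
  have : Nonempty (Metric.sphere (0 : E n) 1) :=
    (NormedSpace.sphere_nonempty.2 zero_le_one).to_subtype
  have hlow : (ν * μ) / L ≤ minStretch D := by
    refine le_ciInf fun h => ?_
    rw [happ, div_le_iff₀ hL0]
    have := hA₂ (μ • (ℝ ∙ y)ᗮ.reflection h)
    rw [hnm, show ‖(h : E n)‖ = 1 from by simp] at this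
    calc ν * μ = ν * (μ * 1) := by ring
      _ ≤ ν * (L * ‖A (μ • (ℝ ∙ y)ᗮ.reflection h)‖) := by gcongr
      _ = _ := by ring
  rw [hDdet]
  constructor
  · rw [← mul_pow]
    gcongr
  · rw [← mul_pow]
    have : ν * μ ≤ L * minStretch D := by
      rw [div_le_iff₀ hL0] at hlow; linarith
    gcongr

theorem dilatation_invConj [Nontrivial (E n)] {L : ℝ} (hL : 1 ≤ L) {x : E n} (hxq : x ≠ q)
    (hx : x ∈ finiteDomain (invConj p q hr F)) {A : E n →L[ℝ] E n}
    (hF : HasFDerivAt F A (inversion q r x)) (hdet : LinearMap.det (A : E n →ₗ[ℝ] E n) = 1)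
    (hA₁ : ∀ h, ‖A h‖ ≤ L * ‖h‖) (hA₂ : ∀ h, ‖h‖ ≤ L * ‖A h‖) :
    ‖fderiv ℝ (finitePart (invConj p q hr F)) x‖ ^ n ≤
        L ^ n * (fderiv ℝ (finitePart (invConj p q hr F)) x).det ∧
      (fderiv ℝ (finitePart (invConj p q hr F)) x).det ≤
        L ^ n * minStretch (fderiv ℝ (finitePart (invConj p q hr F)) x) ^ n := by
  have hp : F (inversion q r x) ≠ p := (mem_finiteDomain_invConj.1 hx).resolve_left hxq
  have hder := (hasFDerivAt_inversion (R := 1) hp).comp x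
    (hF.comp x (hasFDerivAt_inversion (R := r) hxq))
  have hev : finitePart (invConj p q hr F) =ᶠ[𝓝 x]
      (inversion p 1 ∘ (F ∘ inversion q r)) := by
    filter_upwards [(isOpen_finiteDomain _).mem_nhds hx, isOpen_ne.mem_nhds hxq] with y hy hyq
    exact finitePart_invConj hyq ((mem_finiteDomain_invConj.1 hy).resolve_left hyq)
  have hd1 : 0 < dist x q := dist_pos.2 hxq
  have hd2 : 0 < dist (F (inversion q r x)) p := dist_pos.2 hp
  exact dilatation_bounds hL (μ := (r / dist x q) ^ 2)
    (ν := (1 / dist (F (inversion q r x)) p) ^ 2) (by positivity) (by positivity) hdet hA₁ hA₂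
    (sub_ne_zero.2 hxq) (sub_ne_zero.2 hp) (hder.congr_of_eventuallyEq hev).fderiv

end InvConj

/-! ### The folding shear -/

section FoldShear

/-- The shear `y ↦ p + (y - q) - |⟪w, y - q⟫ - τ| b` along `b ⟂ w`. -/
def foldShear {w b : E n} (hwb : inner ℝ w b = (0 : ℝ)) (p q : E n) (τ : ℝ) : E n ≃ₜ E n where
  toFun y := p + (y - q) - |inner ℝ w (y - q) - τ| • b
  -- As `b ⟂ w`, the shear preserves the argument of the absolute value, so the inverse only changes
  -- a sign.
  invFun z := q + (z - p) + |inner ℝ w (z - p) - τ| • b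
  left_inv y := by
    have : p + (y - q) - |inner ℝ w (y - q) - τ| • b - p = (y - q) - |inner ℝ w (y - q) - τ| • b := by
      abel
    simp only [this, inner_sub_right w (y - q), real_inner_smul_right, hwb, mul_zero, sub_zero]
    abel
  right_inv z := by
    have : q + (z - p) + |inner ℝ w (z - p) - τ| • b - q = (z - p) + |inner ℝ w (z - p) - τ| • b := by
      abel
    simp only [this, inner_add_right w (z - p), real_inner_smul_right, hwb, mul_zero, add_zero]
    abel
  continuous_toFun := by fun_prop
  continuous_invFun := by fun_prop

variable {w b : E n} {hwb : inner ℝ w b = (0 : ℝ)} {p q : E n} {τ : ℝ}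

theorem foldShear_apply (y : E n) :
    foldShear hwb p q τ y = p + (y - q) - |inner ℝ w (y - q) - τ| • b := rfl

theorem foldShear_symm_apply (z : E n) :
    (foldShear hwb p q τ).symm z = q + (z - p) + |inner ℝ w (z - p) - τ| • b := rfl

theorem norm_fold_sub_le (w b : E n) (τ : ℝ) (x y : E n) :
    ‖(|inner ℝ w x - τ| - |inner ℝ w y - τ|) • b‖ ≤ ‖w‖ * ‖b‖ * ‖x - y‖ := by
  rw [norm_smul, Real.norm_eq_abs]
  have h1 := abs_abs_sub_abs_le_abs_sub (inner ℝ w x - τ) (inner ℝ w y - τ)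
  rw [sub_sub_sub_cancel_right, ← inner_sub_right] at h1
  have h2 := h1.trans (abs_real_inner_le_norm w (x - y))
  calc _ ≤ ‖w‖ * ‖x - y‖ * ‖b‖ := by gcongr
    _ = _ := by ring

theorem lipschitzWith_foldShear : LipschitzWith (1 + ‖w‖₊ * ‖b‖₊) (foldShear hwb p q τ) := by
  refine LipschitzWith.of_dist_le_mul fun x y => ?_
  have e : foldShear hwb p q τ x - foldShear hwb p q τ y =
      (x - y) - (|inner ℝ w (x - q) - τ| - |inner ℝ w (y - q) - τ|) • b := by
    rw [foldShear_apply, foldShear_apply, sub_smul]; abel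
  have h := norm_fold_sub_le w b τ (x - q) (y - q)
  rw [sub_sub_sub_cancel_right] at h
  rw [dist_eq_norm, dist_eq_norm, e]
  push_cast
  linarith [norm_sub_le (x - y) ((|inner ℝ w (x - q) - τ| - |inner ℝ w (y - q) - τ|) • b)]

theorem antilipschitzWith_foldShear : AntilipschitzWith (1 + ‖w‖₊ * ‖b‖₊) (foldShear hwb p q τ) := by
  have h : LipschitzWith (1 + ‖w‖₊ * ‖b‖₊) (foldShear hwb p q τ).symm := by
    refine LipschitzWith.of_dist_le_mul fun x y => ?_
    have e : (foldShear hwb p q τ).symm x - (foldShear hwb p q τ).symm y =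
        (x - y) + (|inner ℝ w (x - p) - τ| - |inner ℝ w (y - p) - τ|) • b := by
      rw [foldShear_symm_apply, foldShear_symm_apply, sub_smul]; abel
    have h := norm_fold_sub_le w b τ (x - p) (y - p)
    rw [sub_sub_sub_cancel_right] at h
    rw [dist_eq_norm, dist_eq_norm, e]
    push_cast
    linarith [norm_add_le (x - y) ((|inner ℝ w (x - p) - τ| - |inner ℝ w (y - p) - τ|) • b)]
  exact h.to_rightInverse (foldShear hwb p q τ).symm_apply_apply

/-- Off the fold the derivative is the transvection `h ↦ h - σ ⟪w, h⟫ b` with `σ = ±1`; its inverse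
has the opposite sign and obeys the same norm bound. -/
theorem exists_hasFDerivAt_foldShear {y : E n} (hy : inner ℝ w (y - q) ≠ τ) :
    ∃ A : E n →L[ℝ] E n, HasFDerivAt (foldShear hwb p q τ) A y ∧
      LinearMap.det (A : E n →ₗ[ℝ] E n) = 1 ∧
      (∀ h, ‖A h‖ ≤ (1 + ‖w‖ * ‖b‖) * ‖h‖) ∧ ∀ h, ‖h‖ ≤ (1 + ‖w‖ * ‖b‖) * ‖A h‖ := by
  obtain ⟨σ, hσ, hd⟩ : ∃ σ : ℝ, |σ| = 1 ∧ HasDerivAt (fun t : ℝ => |t|) σ (inner ℝ w (y - q) - τ) := by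
    rcases lt_or_gt_of_ne hy with h | h
    · exact ⟨-1, by simp, hasDerivAt_abs_neg (by linarith)⟩
    · exact ⟨1, by simp, hasDerivAt_abs_pos (by linarith)⟩
  have hbound : ∀ k : E n, ‖(σ * inner ℝ w k) • b‖ ≤ ‖w‖ * ‖b‖ * ‖k‖ := by
    intro k
    rw [norm_smul, Real.norm_eq_abs, abs_mul, hσ, one_mul]
    calc _ ≤ ‖w‖ * ‖k‖ * ‖b‖ := by gcongr; exact abs_real_inner_le_norm w k
      _ = _ := by ring
  have happ : ∀ h, (ContinuousLinearMap.id ℝ (E n) - (σ • innerSL ℝ w).smulRight b) h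
      = h - (σ * inner ℝ w h) • b := fun h => by simp
  refine ⟨ContinuousLinearMap.id ℝ (E n) - (σ • innerSL ℝ w).smulRight b, ?_, ?_, ?_, ?_⟩
  · have h1 : HasFDerivAt (fun y : E n => inner ℝ w (y - q) - τ) (innerSL ℝ w) y := by
      have := ((innerSL ℝ w).hasFDerivAt (x := y - q)).comp y ((hasFDerivAt_id y).sub_const q)
      simpa using this.sub_const τ
    have h2 := (hd.comp_hasFDerivAt y h1).smul_const b
    have h3 := (((hasFDerivAt_id y).sub_const q).const_add p).sub h2
    exact h3
  · have : ((ContinuousLinearMap.id ℝ (E n) - (σ • innerSL ℝ w).smulRight b : E n →L[ℝ] E n) :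
        E n →ₗ[ℝ] E n) = LinearMap.transvection (-(σ • innerSL ℝ w : E n →L[ℝ] ℝ).toLinearMap) b := by
      ext1 h
      simp [LinearMap.transvection, sub_eq_add_neg]
    rw [this, LinearMap.transvection.det]
    simp [hwb]
  · intro h
    rw [happ]
    linarith [norm_sub_le h ((σ * inner ℝ w h) • b), hbound h]
  · intro h
    set k := (ContinuousLinearMap.id ℝ (E n) - (σ • innerSL ℝ w).smulRight b) h with hk
    have e : h = k + (σ * inner ℝ w k) • b := by
      rw [hk, happ, inner_sub_right, real_inner_smul_right, hwb, mul_zero, sub_zero, sub_add_cancel]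
    have h1 := norm_add_le k ((σ * inner ℝ w k) • b)
    rw [← e] at h1
    linarith [hbound k]

theorem volume_hyperplane (hw : w ≠ 0) (q : E n) (τ : ℝ) :
    volume {z : E n | inner ℝ w (z - q) = τ} = 0 := by
  have hn : ‖w‖ ^ 2 ≠ 0 := by positivity
  have h := Measure.addHaar_submodule volume (LinearMap.ker (innerSL ℝ w : E n →L[ℝ] ℝ).toLinearMap)
    (fun h => hn (by
      have : w ∈ LinearMap.ker (innerSL ℝ w : E n →L[ℝ] ℝ).toLinearMap := h ▸ Submodule.mem_top
      simpa [real_inner_self_eq_norm_sq] using this))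
  rw [← measure_preimage_add_right volume (-q - (τ / ‖w‖ ^ 2) • w)] at h
  convert h using 2
  ext z
  have : z + (-q - (τ / ‖w‖ ^ 2) • w) = (z - q) - (τ / ‖w‖ ^ 2) • w := by abel
  simp only [mem_preimage, SetLike.mem_coe, LinearMap.mem_ker, mem_ofPred_eq, this]
  simp only [ContinuousLinearMap.coe_coe, innerSL_apply_apply, inner_sub_right _ (z - q),
    real_inner_smul_right, real_inner_self_eq_norm_sq, div_mul_cancel₀ _ hn]
  rw [sub_eq_zero]

theorem isQuasiconformalExt_invConj_foldShear (hn : 2 ≤ n) (hw : w ≠ 0) {r : ℝ} (hr : 0 < r) :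
    IsQuasiconformalExt ((1 + ‖w‖ * ‖b‖) ^ n) (invConj p q hr (foldShear hwb p q τ)) := by
  have : NeZero n := ⟨by omega⟩
  have hL : 1 ≤ 1 + ‖w‖ * ‖b‖ := by
    have : 0 ≤ ‖w‖ * ‖b‖ := by positivity
    linarith
  refine isQuasiconformalExt_of_locallyLipschitzOn (one_le_pow₀ hL)
    (locallyLipschitzOn_invConj lipschitzWith_foldShear antilipschitzWith_foldShear) ?_
  -- The composite may fail to be differentiable on the inverted fold hyperplane, which is null
  -- because inversion is differentiable away from `q`.
  have hnull : volume (inversion q r '' ({z : E n | inner ℝ w (z - q) = τ} \ {q})) = 0 := by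
    refine addHaar_image_eq_zero_of_differentiableOn_of_addHaar_eq_zero volume ?_
      (measure_mono_null sdiff_subset (volume_hyperplane hw q τ))
    intro z hz
    exact (hasFDerivAt_inversion hz.2).differentiableAt.differentiableWithinAt
  have h1 : ∀ᵐ x : E n, x ≠ q := by
    simp [ae_iff]
  rw [ae_restrict_iff' (isOpen_finiteDomain _).measurableSet]
  filter_upwards [h1, measure_eq_zero_iff_ae_notMem.1 hnull] with x hxq hxn hx
  have hne : inner ℝ w (inversion q r x - q) ≠ τ := by
    intro h
    refine hxn ⟨inversion q r x, ⟨h, ?_⟩, inversion_inversion q hr.ne' x⟩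
    simpa [inversion_eq_center hr.ne'] using hxq
  obtain ⟨A, hA, hdet, hA₁, hA₂⟩ := exists_hasFDerivAt_foldShear (hwb := hwb) (p := p) hne
  exact dilatation_invConj hL hxq hx hA hdet hA₁ hA₂

end FoldShear

/-! ### Unions of two balls as images of the unit ball -/

/-- This is `max a b = (a + b) / 2 + |a - b| / 2`. -/
theorem half_abs_sub_lt_or_iff {a b : ℝ} :
    |a - b| / 2 < a ∨ |a - b| / 2 < b ↔ 0 < a + b := by
  rcases le_total a b with h | h
  · rw [abs_of_nonpos (by linarith)]
    constructor
    · rintro (h | h) <;> linarith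
    · intro h; right; linarith
  · rw [abs_of_nonneg (by linarith)]
    constructor
    · rintro (h | h) <;> linarith
    · intro h; left; linarith

theorem sphereInv_preimage_unitBall {q : E n} (hq : ‖q‖ = 1) {r : ℝ} (hr : 0 < r) :
    sphereInv q r ⁻¹' toExt (Metric.ball 0 1) = genBall 0 (-q) (-2 + r ^ 2) := by
  have hq0 : quad (1 / 1) ((1 / 1 : ℝ) • (0 : E n)) ((‖(0 : E n)‖ ^ 2 - 1 ^ 2) / 1) q = 0 := by
    simp [quad, hq]
  rw [toExt_ball 0 one_pos, sphereInv_preimage_genBall q hr, hq0]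
  congr 1
  · simp
  · simp
  · simp [hq]

theorem isQuasiball_union_ball (hn : 2 ≤ n) {x₁ x₂ : E n} {r₁ r₂ ρ : ℝ} (hr₁ : 0 < r₁)
    (hr₂ : 0 < r₂) (h1 : |r₂ - r₁| < dist x₁ x₂) (h2 : dist x₁ x₂ < r₁ + r₂)
    (hρ : ρ = (r₁ ^ 2 + r₂ ^ 2 - dist x₁ x₂ ^ 2) / (2 * r₁ * r₂)) :
    IsQuasiball ((1 + √((1 - ρ) / (1 + ρ))) ^ n)
      (toExt (Metric.ball x₁ r₁ ∪ Metric.ball x₂ r₂)) := by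
  have hρI := lorentzProduct_mem hr₁ hr₂ h1 h2
  rw [← hρ] at hρI
  obtain ⟨p, hp₁, hp₂⟩ := exists_dist_eq_dist_eq hn hr₁ h1 h2
  have hu₁ := norm_normal hr₁ hp₁
  have hu₂ := norm_normal hr₂ hp₂
  have hu := inner_normal hr₁ hr₂ hp₁ hp₂
  have hS₁ := sphereInv_preimage_ball hr₁ hp₁
  have hS₂ := sphereInv_preimage_ball hr₂ hp₂
  rw [← hρ] at hu
  set u₁ := (1 / r₁) • (x₁ - p)
  set u₂ := (1 / r₂) • (x₂ - p)
  have hu' : inner ℝ u₂ u₁ = ρ := by rw [real_inner_comm, hu]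
  have hi₁ : 0 < 1 + ρ := by linarith [hρI.1]
  have hi₂ : 0 < 1 - ρ := by linarith [hρI.2]
  have hm2 : ‖u₁ + u₂‖ ^ 2 = 2 * (1 + ρ) := by rw [norm_add_sq_real, hu₁, hu₂, hu]; ring
  have hw2 : ‖u₁ - u₂‖ ^ 2 = 2 * (1 - ρ) := by rw [norm_sub_sq_real, hu₁, hu₂, hu]; ring
  have hm : 0 < ‖u₁ + u₂‖ := by
    refine lt_of_le_of_ne (norm_nonneg _) fun h => ?_
    rw [← h] at hm2; linarith
  have hw : u₁ - u₂ ≠ 0 := by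
    intro h
    rw [h, norm_zero] at hw2; linarith
  set M := ‖u₁ + u₂‖ with hM
  -- Scaled so that `⟪u₁, b⟫ = ⟪u₂, b⟫ = 1 / 2`, the coefficient in `half_abs_sub_lt_or_iff`.
  set b : E n := (1 / M ^ 2) • (u₁ + u₂) with hb
  have hwb : inner ℝ (u₁ - u₂) b = (0 : ℝ) := by
    rw [hb, real_inner_smul_right, inner_sub_left, inner_add_right, inner_add_right,
      real_inner_self_eq_norm_sq, real_inner_self_eq_norm_sq, hu₁, hu₂, hu, hu']
    ring
  have hbn : ‖b‖ = 1 / M := by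
    rw [hb, norm_smul, ← hM, Real.norm_of_nonneg (by positivity)]
    field_simp
  have hK : √((1 - ρ) / (1 + ρ)) = ‖u₁ - u₂‖ * ‖b‖ := by
    rw [hbn, mul_one_div, Real.sqrt_eq_iff_mul_self_eq (by positivity) (by positivity), ← sq,
      div_pow, hm2, hw2]
    field_simp
  -- The inverted balls are the half-spaces `⟪uᵢ, z - p⟫ > kᵢ`.
  set k₁ := 1 / (2 * r₁) with hk₁
  set k₂ := 1 / (2 * r₂) with hk₂
  have hk₁0 : 0 < k₁ := by positivity
  have hk₂0 : 0 < k₂ := by positivity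
  set q : E n := -((1 / M) • (u₁ + u₂)) with hq
  have hqn : ‖q‖ = 1 := by
    rw [hq, norm_neg, norm_smul, ← hM, Real.norm_of_nonneg (by positivity),
      one_div_mul_cancel hm.ne']
  -- With this radius the inversion at `q` sends the unit ball to `⟪u₁ + u₂, y - q⟫ > k₁ + k₂`.
  have hr : 0 < √(2 * (k₁ + k₂) / M) := Real.sqrt_pos.2 (by positivity)
  have hr2 : √(2 * (k₁ + k₂) / M) ^ 2 = 2 * (k₁ + k₂) / M := Real.sq_sqrt (by positivity)
  set r := √(2 * (k₁ + k₂) / M)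
  set F := foldShear hwb p q (k₁ - k₂) with hF
  refine ⟨invConj p q hr F, ?_, ?_⟩
  · rw [hK]
    exact isQuasiconformalExt_invConj_foldShear hn hw hr
  have hmid : OnePoint.map F ⁻¹' (sphereInv p 1 ⁻¹'
      toExt (Metric.ball x₁ r₁ ∪ Metric.ball x₂ r₂)) = sphereInv q r ⁻¹' toExt (Metric.ball 0 1) := by
    rw [toExt_union, preimage_union, hS₁, hS₂, sphereInv_preimage_unitBall hqn hr]
    ext z
    induction z using OnePoint.rec with
    | infty => simp [infty_mem_genBall]
    | coe y =>
      simp only [mem_preimage, OnePoint.map_some, mem_union, coe_mem_genBall]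
      have hb₁ : inner ℝ u₁ b = 1 / 2 := by
        rw [hb, real_inner_smul_right, inner_add_right, real_inner_self_eq_norm_sq, hu₁, hu, hm2]
        field_simp
      have hb₂ : inner ℝ u₂ b = 1 / 2 := by
        rw [hb, real_inner_smul_right, inner_add_right, real_inner_self_eq_norm_sq, hu₂, hu', hm2]
        field_simp; ring
      set Y := y - q with hY
      have hFy : F y = p + Y - |(inner ℝ u₁ Y - k₁) - (inner ℝ u₂ Y - k₂)| • b := by
        rw [hF, foldShear_apply, ← hY, inner_sub_left]
        congr 3; ring
      set t := |(inner ℝ u₁ Y - k₁) - (inner ℝ u₂ Y - k₂)| with ht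
      have e₁ : quad 0 u₁ (2 * inner ℝ u₁ p + 1 / r₁) (F y) = 2 * (t / 2 - (inner ℝ u₁ Y - k₁)) := by
        rw [quad, hFy, inner_sub_right, inner_add_right, real_inner_smul_right, hb₁, hk₁]
        field_simp; ring
      have e₂ : quad 0 u₂ (2 * inner ℝ u₂ p + 1 / r₂) (F y) = 2 * (t / 2 - (inner ℝ u₂ Y - k₂)) := by
        rw [quad, hFy, inner_sub_right, inner_add_right, real_inner_smul_right, hb₂, hk₂]
        field_simp; ring
      have e₃ : quad 0 (-q) (-2 + r ^ 2) y
          = 2 / M * -((inner ℝ u₁ Y - k₁) + (inner ℝ u₂ Y - k₂)) := by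
        have hy : y = q + Y := by rw [hY]; abel
        have hYq : inner ℝ q Y = -(1 / M * (inner ℝ u₁ Y + inner ℝ u₂ Y)) := by
          rw [hq, inner_neg_left, real_inner_smul_left, inner_add_left]
        rw [quad, hy, inner_neg_left, inner_add_right, real_inner_self_eq_norm_sq, hqn, hYq, hr2]
        field_simp; ring
      rw [e₁, e₂, e₃]
      have hM' : 0 < 2 / M := by positivity
      have := half_abs_sub_lt_or_iff (a := inner ℝ u₁ Y - k₁) (b := inner ℝ u₂ Y - k₂)
      rw [← ht] at this
      have hneg : ∀ {c d : ℝ}, 0 < c → (c * d < 0 ↔ d < 0) := fun hc =>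
        smul_neg_iff_of_pos_left hc
      rw [hneg hM', hneg two_pos, hneg two_pos, sub_neg, sub_neg, this, neg_lt_zero]
  have hpre : invConj p q hr F ⁻¹' toExt (Metric.ball x₁ r₁ ∪ Metric.ball x₂ r₂)
      = toExt (Metric.ball 0 1) := by
    have : invConj p q hr F ⁻¹' toExt (Metric.ball x₁ r₁ ∪ Metric.ball x₂ r₂)
        = sphereInv q r ⁻¹' (OnePoint.map F ⁻¹' (sphereInv p 1 ⁻¹'
          toExt (Metric.ball x₁ r₁ ∪ Metric.ball x₂ r₂))) := rfl
    rw [this, hmid, ← preimage_comp, (sphereInv_involutive q hr).comp_self, preimage_id]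
  rw [← hpre, image_preimage_eq _ (invConj p q hr F).surjective]

end QuasiballUnion

end

/-- There is a function `K` of the dimension and of the angle alone such that, for properly
intersecting balls `B₁, B₂`, the angle of intersection is well defined (it exists and is unique)
and `B₁ ∪ B₂` is a `K n α`-quasiball when `α` is this angle. -/
theorem mainTheorem6 :
    ∃ K : ℕ → ℝ → ℝ, ∀ (n : ℕ) (hn : 2 ≤ n) (x₁ x₂ : EuclideanSpace ℝ (Fin n)) (r₁ r₂ : ℝ),
      0 < r₁ → 0 < r₂ → |r₂ - r₁| < dist x₁ x₂ → dist x₁ x₂ < r₁ + r₂ →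
        (∃! α : ℝ, QuasiballUnion.IsAngleOfIntersection hn
          (Metric.ball x₁ r₁) (Metric.ball x₂ r₂) α) ∧
        ∀ α : ℝ, QuasiballUnion.IsAngleOfIntersection hn
            (Metric.ball x₁ r₁) (Metric.ball x₂ r₂) α →
          QuasiballUnion.IsQuasiball (K n α)
            (QuasiballUnion.toExt (Metric.ball x₁ r₁ ∪ Metric.ball x₂ r₂)) := by
  -- For `α` in `(π, 2π)` the square root is `tan ((α - π) / 2)`.
  refine ⟨fun n α => (1 + √((1 - Real.cos (α - Real.pi)) / (1 + Real.cos (α - Real.pi)))) ^ n,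
    fun n hn x₁ x₂ r₁ r₂ hr₁ hr₂ h1 h2 => ⟨?_, fun α hα => ?_⟩⟩
  · exact QuasiballUnion.existsUnique_isAngleOfIntersection hn hr₁ hr₂ h1 h2
  · exact QuasiballUnion.isQuasiball_union_ball hn hr₁ hr₂ h1 h2
      (QuasiballUnion.cos_of_isAngleOfIntersection hn hr₁ hr₂ hα)
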